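/- Let $a,b,c,d$ be nonnegative integers with $bc\neq 0$, $S:=a+b=c+d$, and let $m:=a-c=d-b$. Assume that $\sigma:=m/S>\tfrac12$. For $A\in\mathbb R$, let $\mathcal M_2(A)$ be the set of probability measures on $\mathbb R$ with expectation $A$ and finite second moment, with the Wasserstein distance $d_W(\mu_1,\mu_2)=\inf\big(\mathbb E(X_1-X_2)^2\big)^{1/2}$, the infimum being over all couplings $(X_1,X_2)$ of $\mu_1,\mu_2$. Equip products $\mathcal M_2(B)\times\mathcal M_2(C)$ with the distance $d\big((\mu_1,\nu_1),(\mu_2,\nu_2)\big)=\max\{d_W(\mu_1,\mu_2),d_W(\nu_1,\nu_2)\}$. Let $V=(V_1,\dots,V_{S+1})$ have the Dirichlet distribution with parameters $(\frac1S,\dots,\frac1S)$. For probability measures $\mu,\nu$ on $\mathbb R$, let $K(\mu,\nu)=(K_1(\mu,\nu),K_2(\mu,\nu))$, where $$K_1(\mu,\nu)=\mathcal L\Big(\sum_{k=1}^{a+1}V_k^{\sigma}X^{(k)}+\sum_{k=a+2}^{S+1}V_k^{\sigma}Y^{(k)}\Big),\qquad K_2(\mu,\nu)=\mathcal L\Big(\sum_{k=1}^{c}V_k^{\sigma}X^{(k)}+\sum_{k=c+1}^{S+1}V_k^{\sigma}Y^{(k)}\Big),$$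 the $X^{(k)}$ having law $\mu$, the $Y^{(k)}$ having law $\nu$, and all of these variables and $V$ being independent. A pair $(\mu,\nu)$ is a solution of the distributional system if $(\mu,\nu)=K(\mu,\nu)$, i.e. if $X\sim\mu$ and $Y\sim\nu$ satisfy $$X\overset{\mathcal L}{=}\sum_{k=1}^{a+1}V_k^{\sigma}X^{(k)}+\sum_{k=a+2}^{S+1}V_k^{\sigma}Y^{(k)},\qquad Y\overset{\mathcal L}{=}\sum_{k=1}^{c}V_k^{\sigma}X^{(k)}+\sum_{k=c+1}^{S+1}V_k^{\sigma}Y^{(k)}.$$ Consider finally the urn process $U=(U(n))_{n\ge0}$ with replacement matrix $\begin{pmatrix}a&b\\c&d\end{pmatrix}$: the Markov chain on $\mathbb N^2$ of (red, black) compositions in which, at each step, a ball is drawn uniformly from the urn and put back, and $(a,b)$ is added to the composition if the ball was red, $(c,d)$ if it was black. Write $U_{(\alpha,\beta)}$ for this process started at $(\alpha,\beta)$, and $u_2(x,y)=\frac{bx-cy}{S}$. Then the following hold. 1. Let $B,C\in\mathbb R$ satisfy $cB+bC=0$. Then $K$ maps $\mathcal M_2(B)\times\mathcal M_2(C)$ into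 itself and is $\sqrt{\frac{S+1}{2m+1}}$-Lipschitz there for $d$, and $\sqrt{\frac{S+1}{2m+1}}<1$, so that $K$ is a contraction. 2. Let $B,C\in\mathbb R$ satisfy $cB+bC=0$. Then the distributional system has a unique solution in $\mathcal M_2(B)\times\mathcal M_2(C)$. 3. The limits $$W^{DT}_{(1,0)}=\lim_{n\to\infty}\frac{u_2\big(U_{(1,0)}(n)\big)}{n^{\sigma}},\qquad W^{DT}_{(0,1)}=\lim_{n\to\infty}\frac{u_2\big(U_{(0,1)}(n)\big)}{n^{\sigma}}$$ exist almost surely, and the pair of the laws of $W^{DT}_{(1,0)}$ and $W^{DT}_{(0,1)}$ is the unique solution of the distributional system among pairs of probability measures with finite second moments and respective expectations $$\frac{\Gamma(\frac1S)}{\Gamma(\frac{m+1}S)}\,\frac bS\qquad\text{and}\qquad-\frac{\Gamma(\frac1S)}{\Gamma(\frac{m+1}S)}\,\frac cS .$$ -/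

import Mathlib

open Filter Topology MeasureTheory
open scoped ENNReal

noncomputable section

/-! ### The two-color urn process -/

/-- One-step transition probability of the urn with replacement matrix `(a, b; c, d)`: from the
composition `x = (red, black)`, a ball is drawn uniformly; a red draw adds `(a, b)`, a black draw
adds `(c, d)`. -/
def urnStep (a b c d : ℕ) (x y : ℕ × ℕ) : ℝ≥0∞ :=
  (if y = (x.1 + a, x.2 + b) then (x.1 : ℝ≥0∞) / ((x.1 : ℝ≥0∞) + (x.2 : ℝ≥0∞)) else 0) +
  (if y = (x.1 + c, x.2 + d) then (x.2 : ℝ≥0∞) / ((x.1 : ℝ≥0∞) + (x.2 : ℝ≥0∞)) else 0)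

/-- `U` is a discrete-time two-color Pólya urn process under `P`, with replacement matrix
`(a, b; c, d)` and initial composition `x₀`: the Markov chain started at `x₀` with transition
probabilities `urnStep a b c d`. -/
structure IsPolyaUrn {Ω : Type*} [MeasurableSpace Ω] (P : Measure Ω) (a b c d : ℕ) (x₀ : ℕ × ℕ)
    (U : ℕ → Ω → ℕ × ℕ) : Prop where
  measurable : ∀ n, Measurable (U n)
  initial : ∀ᵐ ω ∂P, U 0 ω = x₀
  transition : ∀ (n : ℕ) (h : ℕ → ℕ × ℕ),
    P {ω | ∀ i ≤ n + 1, U i ω = h i} =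
      P {ω | ∀ i ≤ n, U i ω = h i} * urnStep a b c d (h n) (h (n + 1))

/-- The linear form `u₂ (x, y) = (b x - c y) / S`. -/
def urnForm (b c S : ℕ) (x : ℕ × ℕ) : ℝ :=
  ((b : ℝ) * (x.1 : ℝ) - (c : ℝ) * (x.2 : ℝ)) / (S : ℝ)

/-- The normalized sequence `u₂ (U n) / n ^ σ` along one trajectory. -/
def urnNormalized (b c S : ℕ) (σ : ℝ) (u : ℕ → ℕ × ℕ) (n : ℕ) : ℝ :=
  urnForm b c S (u n) / (n : ℝ) ^ σ

/-- The limit variable `W = lim u₂ (U n) / n ^ σ`. -/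
def urnLimit {Ω : Type*} (b c S : ℕ) (σ : ℝ) (U : ℕ → Ω → ℕ × ℕ) (ω : Ω) : ℝ :=
  limUnder atTop (urnNormalized b c S σ (fun n => U n ω))

/-! ### Dirichlet distributions -/

/-- The Dirichlet distribution on `ℝ ^ (n + 1)` with parameters `α`: the density
`Γ(∑ αₖ) / ∏ Γ(αₖ) * ∏ xₖ ^ (αₖ - 1)` on the simplex, which is parametrized by its first `n`
coordinates (with Lebesgue measure), the last one being `1 - ∑ xₖ`. -/
def dirichletMeasure (n : ℕ) (α : Fin (n + 1) → ℝ) : Measure (Fin (n + 1) → ℝ) :=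
  ((volume.restrict {x : Fin n → ℝ | (∀ i, 0 ≤ x i) ∧ ∑ i, x i ≤ 1}).map
      (fun x : Fin n → ℝ => (Fin.snoc x (1 - ∑ i, x i) : Fin (n + 1) → ℝ))).withDensity
    (fun y => ENNReal.ofReal
      (Real.Gamma (∑ k, α k) / (∏ k, Real.Gamma (α k)) * ∏ k, y k ^ (α k - 1)))

/-! ### Smoothing transforms and the distributional system -/

/-- The law of `∑_{k ≤ r} V_k ^ σ X_k + ∑_{r < k ≤ S + 1} V_k ^ σ Y_k`, where `V` is
Dirichlet `(1/S, …, 1/S)`-distributed on `ℝ ^ (S + 1)`, the `X_k` have law `μ`, the `Y_k` have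
law `ν`, and all of these are independent. -/
def smoothingLaw (S : ℕ) (σ : ℝ) (r : ℕ) (μ ν : Measure ℝ) : Measure ℝ :=
  ((dirichletMeasure S (fun _ => 1 / (S : ℝ))).prod
      (Measure.pi (fun k : Fin (S + 1) => if (k : ℕ) < r then μ else ν))).map
    (fun p : (Fin (S + 1) → ℝ) × (Fin (S + 1) → ℝ) => ∑ k, p.1 k ^ σ * p.2 k)

/-- The smoothing transform `K = (K₁, K₂)`; the first component has `a + 1` copies of law `μ`,
the second one has `c` of them. -/
def smoothingTransform (a c S : ℕ) (σ : ℝ) (p : Measure ℝ × Measure ℝ) :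
    Measure ℝ × Measure ℝ :=
  (smoothingLaw S σ (a + 1) p.1 p.2, smoothingLaw S σ c p.1 p.2)

/-- The pair of laws `p = (law of X, law of Y)` solves the distributional system. -/
def IsSystemSolution (a c S : ℕ) (σ : ℝ) (p : Measure ℝ × Measure ℝ) : Prop :=
  p.1 = smoothingLaw S σ (a + 1) p.1 p.2 ∧ p.2 = smoothingLaw S σ c p.1 p.2

/-- Probability measures on `ℝ` with a finite second moment and expectation `A`. -/
def M2 (A : ℝ) : Set (Measure ℝ) :=
  {μ | IsProbabilityMeasure μ ∧ MemLp (fun x : ℝ => x) 2 μ ∧ ∫ x, x ∂μ = A}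

/-! ### The Wasserstein distance -/

/-- The Wasserstein distance of order two: the infimum of `(E (X₁ - X₂)²) ^ (1/2)` over all
couplings of `μ₁` and `μ₂`. -/
def wasserstein2 (μ₁ μ₂ : Measure ℝ) : ℝ≥0∞ :=
  ⨅ (π : Measure (ℝ × ℝ)) (_ : π.map Prod.fst = μ₁ ∧ π.map Prod.snd = μ₂),
    (∫⁻ z, ENNReal.ofReal ((z.1 - z.2) ^ 2) ∂π) ^ (1 / 2 : ℝ)

/-- The product distance on pairs of laws. -/
def pairDist (p q : Measure ℝ × Measure ℝ) : ℝ≥0∞ :=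
  max (wasserstein2 p.1 q.1) (wasserstein2 p.2 q.2)

end

noncomputable section

/-! ### Dirichlet integrals -/

/-! Contraction. Couple `μ₁` with `μ₂` and `ν₁` with `ν₂`, and use the same Dirichlet vector `V` in
both smoothing sums. The difference of the sums is `∑ V_k ^ σ D_k`; given `V`, the `D_k` are
independent and centred because the coupled laws have equal means. Cross terms vanish, and only `E
V_k ^ (2σ) = 1 / (2m + 1)` enters, since each `V_k` is Beta`(1/S, 1)`. Summing over `S + 1` terms
gives the squared constant `(S + 1) / (2m + 1)`, which is below one exactly when `σ > 1/2`. Means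
are preserved because `E V_k ^ σ = 1 / (m + 1)` and `cB + bC = 0`. Uniqueness follows, as a
vanishing Wasserstein distance forces equal characteristic functions.

Existence does not go through completeness of the Wasserstein space: the urn itself supplies a
solution. The form `u₂` is an eigenvector of the replacement dynamics, so `u₂ (U n)` divided by `∏
(1 + m / (1 + jS))` is a martingale. This product is of order `n ^ σ`, and `2σ > 1` makes the
martingale bounded in `L²`; Euler's product for Gamma gives the constant in the mean of the limit.
The system is homogeneous, so rescaling this one solution reaches every pair of means on the line
`cB + bC = 0`.

That the limit laws solve the system is a branching argument carried out on generating functions.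
For a multiplicative function `g` on compositions, the exponential generating function of the
iterated generator is multiplicative in the initial composition (`urnSeries_add`). After its first,
forced draw, a one-ball urn contains `S + 1` balls, each the root of its own one-ball urn. The
weights with which these share `n` further draws are multinomial weights averaged over the Dirichlet
law (`integral_multinomialWeight`). With the characters of `u₂` as `g` this becomes an exact
identity of characteristic functions at finite time. It passes to the limit by the law of large
numbers for the shares, obtained from Bernstein approximation. -/

theorem lintegral_beta_unit {α β : ℝ} (hα : 0 < α) (hβ : 0 < β) :
    ∫⁻ x in Set.Ioo (0 : ℝ) 1, ENNReal.ofReal (x ^ (α - 1) * (1 - x) ^ (β - 1)) =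
      ENNReal.ofReal (ProbabilityTheory.beta α β) := by
  have hb := ProbabilityTheory.beta_pos hα hβ
  have h := ProbabilityTheory.lintegral_betaPDF_eq_one hα hβ
  rw [ProbabilityTheory.lintegral_betaPDF] at h
  simp_rw [mul_assoc, ENNReal.ofReal_mul (one_div_pos.2 hb).le] at h
  rw [lintegral_const_mul' _ _ ENNReal.ofReal_ne_top] at h
  rw [one_div, ENNReal.ofReal_inv_of_pos hb] at h
  have h0 : ENNReal.ofReal (ProbabilityTheory.beta α β) ≠ 0 := by simpa using hb
  rwa [← ENNReal.div_eq_inv_mul, ENNReal.div_eq_one_iff h0 ENNReal.ofReal_ne_top] at h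

theorem lintegral_beta_scaled {α β T : ℝ} (hα : 0 < α) (hβ : 0 < β) (hT : 0 < T) :
    ∫⁻ x in Set.Ioo (0 : ℝ) T, ENNReal.ofReal (x ^ (α - 1) * (T - x) ^ (β - 1)) =
      ENNReal.ofReal (T ^ (α + β - 1) * ProbabilityTheory.beta α β) := by
  have himg : (fun u : ℝ => T * u) '' Set.Ioo 0 1 = Set.Ioo 0 T := by
    rw [Set.image_mul_left_Ioo hT]; simp
  rw [← himg, lintegral_image_eq_lintegral_abs_deriv_mul (f' := fun _ => T) measurableSet_Ioo
    (fun x _ => by simpa using ((hasDerivAt_id x).const_mul T).hasDerivWithinAt)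
    ((mul_right_injective₀ hT.ne').injOn)]
  have : ∀ x ∈ Set.Ioo (0 : ℝ) 1, ENNReal.ofReal |T| *
      ENNReal.ofReal ((T * x) ^ (α - 1) * (T - T * x) ^ (β - 1)) =
      ENNReal.ofReal (T ^ (α + β - 1)) * ENNReal.ofReal (x ^ (α - 1) * (1 - x) ^ (β - 1)) := by
    intro x hx
    rw [← ENNReal.ofReal_mul (abs_nonneg _), ← ENNReal.ofReal_mul (by positivity)]
    congr 1
    have h1 : T - T * x = T * (1 - x) := by ring
    rw [h1, Real.mul_rpow hT.le hx.1.le, Real.mul_rpow hT.le (by linarith [hx.2]), abs_of_pos hT]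
    have h2 : T ^ (α + β - 1) = T * T ^ (α - 1) * T ^ (β - 1) := by
      rw [show α + β - 1 = 1 + (α - 1) + (β - 1) by ring, Real.rpow_add hT, Real.rpow_add hT,
        Real.rpow_one]
    rw [h2]; ring
  rw [setLIntegral_congr_fun measurableSet_Ioo this, lintegral_const_mul' _ _ ENNReal.ofReal_ne_top,
    lintegral_beta_unit hα hβ, ← ENNReal.ofReal_mul (by positivity)]

/-- The solid simplex of size `T`. -/
def solidSimplex (n : ℕ) (T : ℝ) : Set (Fin n → ℝ) := {x | (∀ i, 0 ≤ x i) ∧ ∑ i, x i ≤ T}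

theorem measurableSet_solidSimplex (n : ℕ) (T : ℝ) : MeasurableSet (solidSimplex n T) := by
  have : solidSimplex n T = (⋂ i, {x | 0 ≤ x i}) ∩ {x | ∑ i, x i ≤ T} := by
    ext x; simp [solidSimplex]
  rw [this]
  exact (MeasurableSet.iInter fun i => measurableSet_le (by fun_prop) (by fun_prop)).inter
    (measurableSet_le (by fun_prop) (by fun_prop))

theorem snoc_cons_eq {n : ℕ} (x : ℝ) (y : Fin n → ℝ) (z : ℝ) :
    (Fin.snoc (Fin.cons x y : Fin (n + 1) → ℝ) z : Fin (n + 2) → ℝ) =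
      Fin.cons x (Fin.snoc y z : Fin (n + 1) → ℝ) :=
  (Fin.cons_snoc_eq_snoc_cons x y z).symm

theorem measurable_snoc_sub {n : ℕ} (T : ℝ) :
    Measurable (fun x : Fin n → ℝ => (Fin.snoc x (T - ∑ i, x i) : Fin (n + 1) → ℝ)) := by
  refine measurable_pi_iff.2 fun k => ?_
  refine Fin.lastCases ?_ (fun i => ?_) k
  · simp only [Fin.snoc_last]; fun_prop
  · simp only [Fin.snoc_castSucc]; fun_prop

theorem lintegral_fin_succ {n : ℕ} {f : (Fin (n + 1) → ℝ) → ℝ≥0∞} (hf : Measurable f) :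
    ∫⁻ x, f x = ∫⁻ t : ℝ, ∫⁻ y : Fin n → ℝ, f (Fin.cons t y) := by
  have h := (volume_preserving_piFinSuccAbove (fun _ : Fin (n + 1) => ℝ) 0).symm
  rw [← h.lintegral_comp hf]
  have hc := hf.comp h.measurable
  rw [Measure.volume_eq_prod, lintegral_prod _ (by exact hc.aemeasurable)]
  simp [MeasurableEquiv.piFinSuccAbove, Fin.insertNthEquiv]

/-- Fixing the first coordinate `t` leaves a simplex of size `T - t`, so induction reduces the
Dirichlet integral to one Beta integral on `(0, T)`. The factors `h k` are prescribed only at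
positive arguments because `y ^ (α - 1) * y ^ s = y ^ (α + s - 1)` may fail for real powers at `y ≤
0`. -/
theorem lintegral_solidSimplex (n : ℕ) (β : Fin (n + 1) → ℝ) (hβ : ∀ k, 0 < β k)
    (h : Fin (n + 1) → ℝ → ℝ≥0∞) (hm : ∀ k, Measurable (h k))
    (hh : ∀ k, ∀ y : ℝ, 0 < y → h k y = ENNReal.ofReal (y ^ (β k - 1))) (T : ℝ) (hT : 0 < T) :
    ∫⁻ x in solidSimplex n T, ∏ k, h k ((Fin.snoc x (T - ∑ i, x i) : Fin (n + 1) → ℝ) k) =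
      ENNReal.ofReal (T ^ (∑ k, β k - 1) * ((∏ k, Real.Gamma (β k)) / Real.Gamma (∑ k, β k))) := by
  induction n generalizing T with
  | zero =>
    have hs : solidSimplex 0 T = Set.univ := by
      ext x; simp [solidSimplex, hT.le]
    rw [hs, setLIntegral_univ, Measure.volume_pi_eq_dirac 0, lintegral_dirac]
    simp [hh 0 T hT, (Real.Gamma_pos_of_pos (hβ 0)).ne']
  | succ n ih =>
    have hmeas : Measurable (fun x : Fin (n + 1) → ℝ =>
        ∏ k, h k ((Fin.snoc x (T - ∑ i, x i) : Fin (n + 2) → ℝ) k)) :=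
      Finset.measurable_prod _ fun k _ =>
        (hm k).comp ((measurable_pi_apply k).comp (measurable_snoc_sub T))
    have hmeas' : ∀ U : ℝ, Measurable (fun y : Fin n → ℝ =>
        ∏ k : Fin (n + 1), h k.succ ((Fin.snoc y (U - ∑ i, y i) : Fin (n + 1) → ℝ) k)) :=
      fun U => Finset.measurable_prod _ fun k _ =>
        (hm _).comp ((measurable_pi_apply k).comp (measurable_snoc_sub U))
    rw [← lintegral_indicator (measurableSet_solidSimplex _ _),
      lintegral_fin_succ (hmeas.indicator (measurableSet_solidSimplex _ _))]
    have hpt : ∀ (t : ℝ) (y : Fin n → ℝ),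
        (solidSimplex (n + 1) T).indicator (fun x : Fin (n + 1) → ℝ =>
          ∏ k, h k ((Fin.snoc x (T - ∑ i, x i) : Fin (n + 2) → ℝ) k)) (Fin.cons t y) =
        (Set.Ici (0 : ℝ)).indicator (h 0) t * (solidSimplex n (T - t)).indicator
          (fun y => ∏ k : Fin (n + 1), h k.succ
            ((Fin.snoc y (T - t - ∑ i, y i) : Fin (n + 1) → ℝ) k)) y := by
      intro t y
      have hmem : (Fin.cons t y : Fin (n + 1) → ℝ) ∈ solidSimplex (n + 1) T ↔
          t ∈ Set.Ici (0 : ℝ) ∧ y ∈ solidSimplex n (T - t) := by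
        simp only [solidSimplex, Set.mem_ofPred_eq, Fin.forall_fin_succ, Fin.cons_zero,
          Fin.cons_succ, Fin.sum_univ_succ, Set.mem_Ici, and_assoc]
        constructor <;> rintro ⟨h1, h2, h3⟩ <;> exact ⟨h1, h2, by linarith⟩
      by_cases h1 : t ∈ Set.Ici (0 : ℝ)
      · by_cases h2 : y ∈ solidSimplex n (T - t)
        · rw [Set.indicator_of_mem (hmem.2 ⟨h1, h2⟩), Set.indicator_of_mem h1,
            Set.indicator_of_mem h2, Fin.prod_univ_succ, snoc_cons_eq]
          simp [Fin.sum_univ_succ, sub_sub]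
        · rw [Set.indicator_of_notMem (fun hc => h2 (hmem.1 hc).2), Set.indicator_of_notMem h2,
            mul_zero]
      · rw [Set.indicator_of_notMem (fun hc => h1 (hmem.1 hc).1), Set.indicator_of_notMem h1,
            zero_mul]
    simp_rw [hpt]
    have hb' : 0 < ∑ k : Fin (n + 1), β k.succ :=
      Finset.sum_pos (fun k _ => hβ _) Finset.univ_nonempty
    set s := ∑ k : Fin (n + 1), β k.succ with hs
    have hprod : (0 : ℝ) < ∏ k : Fin (n + 1), Real.Gamma (β k.succ) :=
      Finset.prod_pos fun k _ => Real.Gamma_pos_of_pos (hβ _)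
    have hG := Real.Gamma_pos_of_pos hb'
    have hinner : ∀ᵐ t : ℝ, ∫⁻ y : Fin n → ℝ, (Set.Ici (0 : ℝ)).indicator (h 0) t *
        (solidSimplex n (T - t)).indicator (fun y => ∏ k : Fin (n + 1), h k.succ
            ((Fin.snoc y (T - t - ∑ i, y i) : Fin (n + 1) → ℝ) k)) y =
        (Set.Ioo (0 : ℝ) T).indicator (fun t => ENNReal.ofReal
          ((∏ k : Fin (n + 1), Real.Gamma (β k.succ)) / Real.Gamma s) *
            ENNReal.ofReal (t ^ (β 0 - 1) * (T - t) ^ (s - 1))) t := by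
      -- At `t = 0` the value of `h 0` is unspecified, and at `t = T` the remaining simplex has size
      -- zero, which the induction hypothesis excludes.
      have hne : ∀ᵐ t : ℝ, t ≠ 0 ∧ t ≠ T :=
        (Measure.ae_ne volume (0 : ℝ)).and (Measure.ae_ne volume T)
      filter_upwards [hne] with t ht
      rw [lintegral_const_mul _ ((hmeas' _).indicator (measurableSet_solidSimplex _ _)),
        lintegral_indicator (measurableSet_solidSimplex _ _)]
      rcases lt_or_ge t 0 with h0 | h0
      · rw [Set.indicator_of_notMem (by simpa using h0), Set.indicator_of_notMem
          (fun hc => absurd hc.1 h0.not_gt), zero_mul]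
      have h0 : 0 < t := lt_of_le_of_ne h0 (Ne.symm ht.1)
      rcases lt_or_ge t T with h1 | h1
      · rw [ih (fun k => β k.succ) (fun k => hβ _) (fun k => h k.succ) (fun k => hm _)
          (fun k y hy => hh _ y hy) (T - t) (by linarith),
          Set.indicator_of_mem (show t ∈ Set.Ici (0 : ℝ) from h0.le),
          Set.indicator_of_mem (show t ∈ Set.Ioo 0 T from ⟨h0, h1⟩), hh 0 t h0,
          ← ENNReal.ofReal_mul (by positivity), ← ENNReal.ofReal_mul (by positivity)]
        congr 1; ring
      · have h1 : T < t := lt_of_le_of_ne h1 (Ne.symm ht.2)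
        have : solidSimplex n (T - t) = ∅ := by
          ext y; simp only [solidSimplex, Set.mem_ofPred_eq, Set.mem_empty_iff_false, iff_false]
          rintro ⟨hy, hy'⟩
          have := Finset.sum_nonneg (fun i (_ : i ∈ Finset.univ) => hy i)
          linarith
        rw [this, Measure.restrict_empty, lintegral_zero_measure, mul_zero,
          Set.indicator_of_notMem (fun hc => absurd hc.2 h1.not_gt)]
    rw [lintegral_congr_ae hinner, lintegral_indicator measurableSet_Ioo,
      lintegral_const_mul' _ _ ENNReal.ofReal_ne_top, lintegral_beta_scaled (hβ 0) hb' hT,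
      ← ENNReal.ofReal_mul (by positivity), Fin.sum_univ_succ,
      Fin.prod_univ_succ (fun k => Real.Gamma (β k)), ← hs,
      ProbabilityTheory.beta]
    congr 1
    field_simp

/-! ### Dirichlet distributions: moments -/

theorem lintegral_dirichletMeasure {n : ℕ} {α : Fin (n + 1) → ℝ} {f : (Fin (n + 1) → ℝ) → ℝ≥0∞}
    (hf : Measurable f) :
    ∫⁻ y, f y ∂(dirichletMeasure n α) =
      ∫⁻ x in solidSimplex n 1,
        ENNReal.ofReal (Real.Gamma (∑ k, α k) / (∏ k, Real.Gamma (α k)) *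
          ∏ k, (Fin.snoc x (1 - ∑ i, x i) : Fin (n + 1) → ℝ) k ^ (α k - 1)) *
        f (Fin.snoc x (1 - ∑ i, x i) : Fin (n + 1) → ℝ) := by
  have hd : Measurable (fun y : Fin (n + 1) → ℝ => ENNReal.ofReal
      (Real.Gamma (∑ k, α k) / (∏ k, Real.Gamma (α k)) * ∏ k, y k ^ (α k - 1))) := by fun_prop
  rw [dirichletMeasure, lintegral_withDensity_eq_lintegral_mul _ hd hf,
    lintegral_map (hd.mul hf) (measurable_snoc_sub 1)]
  rfl

theorem snoc_nonneg_of_mem {n : ℕ} {x : Fin n → ℝ} (hx : x ∈ solidSimplex n 1) (k : Fin (n + 1)) :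
    0 ≤ (Fin.snoc x (1 - ∑ i, x i) : Fin (n + 1) → ℝ) k := by
  refine Fin.lastCases ?_ (fun i => ?_) k
  · simpa using hx.2
  · simpa using hx.1 i

theorem ae_dirichletMeasure (n : ℕ) (α : Fin (n + 1) → ℝ) :
    ∀ᵐ y ∂(dirichletMeasure n α), (∀ k, 0 ≤ y k) ∧ ∑ k, y k = 1 := by
  refine (withDensity_absolutelyContinuous _ _).ae_le ?_
  change ∀ᵐ y : Fin (n + 1) → ℝ ∂_, (∀ k, 0 ≤ y k) ∧ ∑ k, y k = 1
  rw [ae_map_iff (measurable_snoc_sub 1).aemeasurable]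
  · refine ae_restrict_of_forall_mem (measurableSet_solidSimplex n 1) fun x hx => ?_
    exact ⟨snoc_nonneg_of_mem hx, by simp [Fin.sum_univ_castSucc]⟩
  · have : {y : Fin (n + 1) → ℝ | (∀ k, 0 ≤ y k) ∧ ∑ k, y k = 1} =
        (⋂ k, {y | 0 ≤ y k}) ∩ {y | ∑ k, y k = 1} := by ext; simp
    rw [this]
    exact (MeasurableSet.iInter fun i => measurableSet_le (by fun_prop) (by fun_prop)).inter
      (measurableSet_eq_fun (by fun_prop) (by fun_prop))

/-- Multiplying a Dirichlet density by powers only shifts its parameters from `α` to `α + s`, so the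
moment is a quotient of two normalizing constants. -/
theorem lintegral_dirichletMeasure_prod_rpow {n : ℕ} {α s : Fin (n + 1) → ℝ}
    (hα : ∀ k, 0 < α k) (hs : ∀ k, 0 < α k + s k) :
    ∫⁻ y, ∏ k, ENNReal.ofReal (y k ^ s k) ∂(dirichletMeasure n α) =
      ENNReal.ofReal (Real.Gamma (∑ k, α k) / (∏ k, Real.Gamma (α k)) *
        ((∏ k, Real.Gamma (α k + s k)) / Real.Gamma (∑ k, (α k + s k)))) := by
  have hΓ : 0 < ∏ k, Real.Gamma (α k) := Finset.prod_pos fun k _ => Real.Gamma_pos_of_pos (hα k)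
  have hΓ' : 0 < Real.Gamma (∑ k, α k) :=
    Real.Gamma_pos_of_pos (Finset.sum_pos (fun k _ => hα k) Finset.univ_nonempty)
  have hc : 0 ≤ Real.Gamma (∑ k, α k) / ∏ k, Real.Gamma (α k) := (div_pos hΓ' hΓ).le
  rw [lintegral_dirichletMeasure (by fun_prop)]
  have key := lintegral_solidSimplex n (fun k => α k + s k) hs
    (fun k y => ENNReal.ofReal (y ^ (α k - 1)) * ENNReal.ofReal (y ^ s k))
    (fun k => by fun_prop)
    (fun k y hy => by
      rw [← ENNReal.ofReal_mul (by positivity), ← Real.rpow_add hy]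
      congr 2; ring) 1 one_pos
  rw [Real.one_rpow, one_mul] at key
  rw [ENNReal.ofReal_mul hc, ← key, ← lintegral_const_mul' _ _ ENNReal.ofReal_ne_top]
  refine setLIntegral_congr_fun (measurableSet_solidSimplex n 1) fun x hx => ?_
  have h0 := snoc_nonneg_of_mem hx
  rw [ENNReal.ofReal_mul hc, ENNReal.ofReal_prod_of_nonneg
    (fun k _ => Real.rpow_nonneg (h0 k) _), Finset.prod_mul_distrib, mul_assoc]

theorem isProbabilityMeasure_dirichletMeasure {n : ℕ} {α : Fin (n + 1) → ℝ} (hα : ∀ k, 0 < α k) :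
    IsProbabilityMeasure (dirichletMeasure n α) := by
  have hΓ : 0 < ∏ k, Real.Gamma (α k) := Finset.prod_pos fun k _ => Real.Gamma_pos_of_pos (hα k)
  have hΓ' : 0 < Real.Gamma (∑ k, α k) :=
    Real.Gamma_pos_of_pos (Finset.sum_pos (fun k _ => hα k) Finset.univ_nonempty)
  have h := lintegral_dirichletMeasure_prod_rpow (s := fun _ => 0) hα (by simpa using hα)
  refine ⟨?_⟩
  simp only [Real.rpow_zero, ENNReal.ofReal_one, Finset.prod_const_one, lintegral_one,
    add_zero] at h
  rw [h, ← ENNReal.ofReal_one]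
  congr 1
  field_simp

/-- The Dirichlet distribution with `S + 1` parameters equal to `1 / S`. -/
abbrev urnDirichlet (S : ℕ) : Measure (Fin (S + 1) → ℝ) := dirichletMeasure S fun _ => 1 / (S : ℝ)

theorem isProbabilityMeasure_urnDirichlet {S : ℕ} (hS : 0 < S) :
    IsProbabilityMeasure (urnDirichlet S) :=
  isProbabilityMeasure_dirichletMeasure fun _ => by positivity

theorem sum_urnDirichlet_param {S : ℕ} (hS : 0 < S) :
    ∑ _k : Fin (S + 1), 1 / (S : ℝ) = 1 / (S : ℝ) + 1 := by
  have : (S : ℝ) ≠ 0 := by positivity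
  simp only [Finset.sum_const, Finset.card_univ, Fintype.card_fin, nsmul_eq_mul]
  push_cast
  field_simp
  ring

/-- The other `S` parameters sum to one, so the marginal is Beta`(1/S, 1)` and the Gamma quotient
collapses. The case `s = 2σ` yields the contraction constant, the case `s = σ` the conservation of
means. -/
theorem lintegral_urnDirichlet_rpow {S : ℕ} (hS : 0 < S) (k : Fin (S + 1)) {s : ℝ} (hs : 0 ≤ s) :
    ∫⁻ y, ENNReal.ofReal (y k ^ s) ∂(urnDirichlet S) = ENNReal.ofReal (1 / (1 + s * S)) := by
  have hS' : (0 : ℝ) < S := by exact_mod_cast hS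
  have h1 : (0 : ℝ) < 1 / S := by positivity
  have h := lintegral_dirichletMeasure_prod_rpow (α := fun _ : Fin (S + 1) => 1 / (S : ℝ))
    (s := Pi.single k s) (fun _ => h1) (fun j => by
      by_cases hj : j = k
      · subst hj; simp only [Pi.single_eq_same]; positivity
      · rw [Pi.single_eq_of_ne hj]; simpa using hS')
  have hp : ∀ y : Fin (S + 1) → ℝ, ∏ j, ENNReal.ofReal (y j ^ (Pi.single k s : _ → ℝ) j) =
      ENNReal.ofReal (y k ^ s) := by
    intro y
    rw [Finset.prod_eq_single k]
    · simp
    · intro j _ hj; rw [Pi.single_eq_of_ne hj]; simp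
    · simp
  simp_rw [hp] at h
  rw [h]
  congr 1
  rw [Finset.sum_add_distrib, sum_urnDirichlet_param hS, Finset.sum_pi_single' k s]
  have hq : ∏ j : Fin (S + 1), Real.Gamma (1 / (S : ℝ) + (Pi.single k s : _ → ℝ) j) =
      Real.Gamma (1 / (S : ℝ) + s) * Real.Gamma (1 / (S : ℝ)) ^ S := by
    rw [← Finset.mul_prod_erase _ _ (Finset.mem_univ k), Pi.single_eq_same]
    congr 1
    rw [Finset.prod_congr rfl (g := fun _ => Real.Gamma (1 / (S : ℝ)))]
    · simp
    · intro j hj; rw [Pi.single_eq_of_ne (Finset.ne_of_mem_erase hj), add_zero]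
  have hG := Real.Gamma_pos_of_pos h1
  have hG' := Real.Gamma_pos_of_pos (show 0 < 1 / (S : ℝ) + s by positivity)
  have hne : 1 / (S : ℝ) + s ≠ 0 := by positivity
  rw [hq, if_pos (Finset.mem_univ _), show 1 / (S : ℝ) + 1 + s = 1 / (S : ℝ) + s + 1 by ring,
    Real.Gamma_add_one hne, Real.Gamma_add_one h1.ne', Finset.prod_const, Finset.card_univ,
    Fintype.card_fin, pow_succ]
  have : 1 + s * S ≠ 0 := by positivity
  field_simp

/-- The rising product `τ (τ + S) ⋯ (τ + (n - 1) S)`. -/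
def rising (S : ℕ) (τ : ℝ) (n : ℕ) : ℝ := ∏ j ∈ Finset.range n, (τ + j * S)

theorem rising_succ (S : ℕ) (τ : ℝ) (n : ℕ) : rising S τ (n + 1) = rising S τ n * (τ + n * S) :=
  Finset.prod_range_succ _ _

theorem rising_succ' (S : ℕ) (τ : ℝ) (n : ℕ) : rising S τ (n + 1) = τ * rising S (τ + S) n := by
  rw [rising, Finset.prod_range_succ']
  simp only [Nat.cast_zero, zero_mul, add_zero, Nat.cast_add, Nat.cast_one, rising]
  rw [mul_comm]
  congr 1
  exact Finset.prod_congr rfl fun j _ => by ring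

theorem rising_pos (S : ℕ) {τ : ℝ} (hτ : 0 < τ) (n : ℕ) : 0 < rising S τ n :=
  Finset.prod_pos fun j _ => by positivity

theorem Gamma_add_nat_eq_rising {S : ℕ} (hS : 0 < S) {τ : ℝ} (hτ : 0 < τ) (n : ℕ) :
    Real.Gamma (τ / S + n) = rising S τ n / (S : ℝ) ^ n * Real.Gamma (τ / S) := by
  have hS' : (0 : ℝ) < S := by exact_mod_cast hS
  induction n with
  | zero => simp [rising]
  | succ n ih =>
    have : τ / S + n ≠ 0 := by positivity
    rw [Nat.cast_succ, ← add_assoc, Real.Gamma_add_one this, ih, rising_succ]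
    field_simp
    ring

/-- Integer moments are quotients of the products `rising`, which also normalize the iterated urn
generator. This coincidence is how the Dirichlet law enters the urn. -/
theorem integral_urnDirichlet_prod_pow {S : ℕ} (hS : 0 < S) (n : Fin (S + 1) → ℕ) :
    ∫ y, ∏ k, y k ^ n k ∂(urnDirichlet S) =
      (∏ k, rising S 1 (n k)) / rising S (S + 1) (∑ k, n k) := by
  have hS' : (0 : ℝ) < S := by exact_mod_cast hS
  have h1 : (0 : ℝ) < 1 / S := by positivity
  have h := lintegral_dirichletMeasure_prod_rpow (α := fun _ : Fin (S + 1) => 1 / (S : ℝ))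
    (s := fun k => n k) (fun _ => h1) (fun k => by positivity)
  have hr : 0 < rising S (S + 1) (∑ k, n k) := rising_pos S (by positivity) _
  have hr' : 0 ≤ ∏ k, rising S 1 (n k) := Finset.prod_nonneg fun k _ => (rising_pos S one_pos _).le
  have hm : Measurable fun y : Fin (S + 1) → ℝ => ∏ k, y k ^ n k := by fun_prop
  rw [integral_eq_lintegral_of_nonneg_ae _ hm.aestronglyMeasurable]
  · rw [lintegral_congr_ae (g := fun y => ∏ k, ENNReal.ofReal (y k ^ (n k : ℝ)))]
    · rw [h, ENNReal.toReal_ofReal]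
      · rw [Finset.sum_add_distrib, sum_urnDirichlet_param hS,
          show 1 / (S : ℝ) + 1 = ((S : ℝ) + 1) / S by field_simp; ring, ← Nat.cast_sum,
          Gamma_add_nat_eq_rising hS (by positivity)]
        simp_rw [Gamma_add_nat_eq_rising hS one_pos]
        rw [Finset.prod_mul_distrib, Finset.prod_div_distrib, Finset.prod_pow_eq_pow_sum]
        have hG : 0 < ∏ k : Fin (S + 1), Real.Gamma (1 / (S : ℝ)) :=
          Finset.prod_pos fun k _ => Real.Gamma_pos_of_pos h1
        have hG' := Real.Gamma_pos_of_pos (show 0 < ((S : ℝ) + 1) / S by positivity)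
        field_simp
      · refine mul_nonneg (div_nonneg ?_ ?_) (div_nonneg ?_ ?_)
        · exact (Real.Gamma_pos_of_pos (Finset.sum_pos (fun k _ => h1) Finset.univ_nonempty)).le
        · exact Finset.prod_nonneg fun k _ => (Real.Gamma_pos_of_pos h1).le
        · exact Finset.prod_nonneg fun k _ => (Real.Gamma_pos_of_pos (by positivity)).le
        · exact (Real.Gamma_pos_of_pos
            (Finset.sum_pos (fun k _ => by positivity) Finset.univ_nonempty)).le
    · filter_upwards [ae_dirichletMeasure S fun _ => 1 / (S : ℝ)] with y hy
      rw [ENNReal.ofReal_prod_of_nonneg fun k _ => pow_nonneg (hy.1 k) _]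
      simp
  · filter_upwards [ae_dirichletMeasure S fun _ => 1 / (S : ℝ)] with y hy
    exact Finset.prod_nonneg fun k _ => pow_nonneg (hy.1 k) _

/-! ### Smoothing laws -/

instance isProbabilityMeasure_ite {X : Type*} [MeasurableSpace X] (μ ν : Measure X)
    [IsProbabilityMeasure μ] [IsProbabilityMeasure ν] (p : Prop) [Decidable p] :
    IsProbabilityMeasure (if p then μ else ν) := by
  split_ifs <;> infer_instance

theorem measurable_weightedSum (S : ℕ) (σ : ℝ) :
    Measurable (fun p : (Fin (S + 1) → ℝ) × (Fin (S + 1) → ℝ) => ∑ k, p.1 k ^ σ * p.2 k) := by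
  fun_prop

theorem isProbabilityMeasure_smoothingLaw {S : ℕ} (hS : 0 < S) (σ : ℝ) (r : ℕ) (μ ν : Measure ℝ)
    [IsProbabilityMeasure μ] [IsProbabilityMeasure ν] :
    IsProbabilityMeasure (smoothingLaw S σ r μ ν) := by
  have := isProbabilityMeasure_urnDirichlet hS
  exact Measure.isProbabilityMeasure_map (measurable_weightedSum S σ).aemeasurable

theorem charFun_smoothingLaw {S : ℕ} (hS : 0 < S) (σ : ℝ) (r : ℕ) (μ ν : Measure ℝ)
    [IsProbabilityMeasure μ] [IsProbabilityMeasure ν] (t : ℝ) :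
    charFun (smoothingLaw S σ r μ ν) t =
      ∫ V, ∏ k : Fin (S + 1), charFun (if (k : ℕ) < r then μ else ν) (t * V k ^ σ)
        ∂(urnDirichlet S) := by
  have := isProbabilityMeasure_urnDirichlet hS
  rw [charFun_apply_real, smoothingLaw,
    integral_map (measurable_weightedSum S σ).aemeasurable (by fun_prop), integral_prod]
  · congr 1 with V
    simp_rw [charFun_apply_real]
    rw [← integral_fintype_prod_eq_prod (𝕜 := ℂ)
      (fun (k : Fin (S + 1)) (x : ℝ) => Complex.exp (((t * V k ^ σ : ℝ) : ℂ) * x * Complex.I))]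
    congr 1 with x
    rw [← Complex.exp_sum]
    congr 1
    push_cast
    rw [Finset.mul_sum, Finset.sum_mul]
    exact Finset.sum_congr rfl fun k _ => by ring
  · refine Integrable.of_bound (C := 1) (by fun_prop) (ae_of_all _ fun p => ?_)
    rw [← Complex.ofReal_mul, Complex.norm_exp_ofReal_mul_I]

/-- The summands are independent and centred, so the second moment of the sum is its variance, which
is additive. -/
theorem lintegral_pi_sq_weightedSum {ι X : Type*} [Fintype ι] [MeasurableSpace X]
    (ρ : ι → Measure X) [∀ k, IsProbabilityMeasure (ρ k)] {D : X → ℝ}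
    (hD : ∀ k, MemLp D 2 (ρ k)) (hD0 : ∀ k, ∫ x, D x ∂(ρ k) = 0) (w : ι → ℝ) :
    ∫⁻ z, ENNReal.ofReal ((∑ k, w k * D (z k)) ^ 2) ∂(Measure.pi ρ) =
      ∑ k, ENNReal.ofReal (w k ^ 2) * ∫⁻ x, ENNReal.ofReal (D x ^ 2) ∂(ρ k) := by
  have hmp : ∀ k, MeasurePreserving (fun z : ι → X => z k) (Measure.pi ρ) (ρ k) :=
    fun k => measurePreserving_eval _ k
  have hw : ∀ k, MemLp (fun x => w k * D x) 2 (ρ k) := fun k => (hD k).const_mul _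
  have hwc : ∀ k, MemLp (fun z : ι → X => w k * D (z k)) 2 (Measure.pi ρ) := fun k =>
    (hw k).comp_measurePreserving (hmp k)
  have hsum : MemLp (fun z : ι → X => ∑ k, w k * D (z k)) 2 (Measure.pi ρ) :=
    memLp_finsetSum _ fun k _ => hwc k
  have hmean : ∫ z, ∑ k, w k * D (z k) ∂(Measure.pi ρ) = 0 := by
    rw [integral_finsetSum _ fun k _ => (hwc k).integrable one_le_two]
    refine Finset.sum_eq_zero fun k _ => ?_
    rw [integral_const_mul]
    have := integral_comp_eval (i := k) (μ := ρ) (hD k).aestronglyMeasurable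
    rw [this, hD0 k, mul_zero]
  have hvar := ProbabilityTheory.variance_sum_pi (X := fun k x => w k * D x) hw
  have hfun : (∑ k, fun z : ι → X => w k * D (z k)) = fun z => ∑ k, w k * D (z k) := by
    ext z; simp
  rw [hfun, ProbabilityTheory.variance_of_integral_eq_zero hsum.aestronglyMeasurable.aemeasurable
    hmean] at hvar
  rw [← ofReal_integral_eq_lintegral_ofReal hsum.integrable_sq (ae_of_all _ fun z => sq_nonneg _),
    hvar, ENNReal.ofReal_sum_of_nonneg fun k _ => ProbabilityTheory.variance_nonneg _ _]
  refine Finset.sum_congr rfl fun k _ => ?_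
  rw [ProbabilityTheory.variance_const_mul, ENNReal.ofReal_mul (sq_nonneg _),
    ProbabilityTheory.variance_of_integral_eq_zero (hD k).aestronglyMeasurable.aemeasurable (hD0 k),
    ofReal_integral_eq_lintegral_ofReal (hD k).integrable_sq (ae_of_all _ fun z => sq_nonneg _)]

theorem lintegral_sq_weightedSum {S : ℕ} (hS : 0 < S) {σ : ℝ} (hσ : 0 ≤ σ) {X : Type*}
    [MeasurableSpace X] (ρ : Fin (S + 1) → Measure X) [∀ k, IsProbabilityMeasure (ρ k)] {D : X → ℝ}
    (hDm : Measurable D) (hD : ∀ k, MemLp D 2 (ρ k)) (hD0 : ∀ k, ∫ x, D x ∂(ρ k) = 0) :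
    ∫⁻ p, ENNReal.ofReal ((∑ k, p.1 k ^ σ * D (p.2 k)) ^ 2)
        ∂((urnDirichlet S).prod (Measure.pi ρ)) =
      ENNReal.ofReal (1 / (1 + 2 * σ * S)) * ∑ k, ∫⁻ x, ENNReal.ofReal (D x ^ 2) ∂(ρ k) := by
  have := isProbabilityMeasure_urnDirichlet hS
  rw [lintegral_prod _ (by fun_prop)]
  simp_rw [lintegral_pi_sq_weightedSum ρ hD hD0]
  rw [lintegral_finsetSum _ fun k _ => by fun_prop, Finset.mul_sum]
  refine Finset.sum_congr rfl fun k _ => ?_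
  rw [lintegral_mul_const _ (by fun_prop)]
  congr 1
  rw [← lintegral_urnDirichlet_rpow hS k (by positivity)]
  refine lintegral_congr_ae ?_
  filter_upwards [ae_dirichletMeasure S fun _ => 1 / (S : ℝ)] with V hV
  rw [← Real.rpow_natCast, ← Real.rpow_mul (hV.1 k)]
  congr 2
  push_cast
  ring

/-! ### Means and second moments -/

theorem integral_urnDirichlet_rpow {S : ℕ} (hS : 0 < S) (k : Fin (S + 1)) {s : ℝ} (hs : 0 ≤ s) :
    ∫ y, y k ^ s ∂(urnDirichlet S) = 1 / (1 + s * S) := by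
  have hm : Measurable fun y : Fin (S + 1) → ℝ => y k ^ s := by fun_prop
  rw [integral_eq_lintegral_of_nonneg_ae _ hm.aestronglyMeasurable,
    lintegral_urnDirichlet_rpow hS k hs, ENNReal.toReal_ofReal (by positivity)]
  filter_upwards [ae_dirichletMeasure S fun _ => 1 / (S : ℝ)] with V hV
  exact Real.rpow_nonneg (hV.1 k) _

theorem rpow_mem_unit_of_simplex {n : ℕ} {V : Fin n → ℝ} (hV : (∀ k, 0 ≤ V k) ∧ ∑ k, V k = 1)
    {σ : ℝ} (hσ : 0 ≤ σ) (k : Fin n) : 0 ≤ V k ^ σ ∧ V k ^ σ ≤ 1 := by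
  have h1 : V k ≤ 1 := hV.2 ▸ Finset.single_le_sum (fun i _ => hV.1 i) (Finset.mem_univ k)
  exact ⟨Real.rpow_nonneg (hV.1 k) _, Real.rpow_le_one (hV.1 k) h1 hσ⟩

theorem memLp_weighted_coordinate {S : ℕ} (hS : 0 < S) {σ : ℝ} (hσ : 0 ≤ σ)
    (ρ : Fin (S + 1) → Measure ℝ) [∀ k, IsProbabilityMeasure (ρ k)] (k : Fin (S + 1))
    (hρ : MemLp (fun x : ℝ => x) 2 (ρ k)) :
    MemLp (fun p : (Fin (S + 1) → ℝ) × (Fin (S + 1) → ℝ) => p.1 k ^ σ * p.2 k) 2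
      ((urnDirichlet S).prod (Measure.pi ρ)) := by
  have := isProbabilityMeasure_urnDirichlet hS
  have h1 : MemLp (fun z : Fin (S + 1) → ℝ => z k) 2 (Measure.pi ρ) :=
    hρ.comp_measurePreserving (measurePreserving_eval _ k)
  have h2 : MemLp (fun p : (Fin (S + 1) → ℝ) × (Fin (S + 1) → ℝ) => p.2 k) 2
      ((urnDirichlet S).prod (Measure.pi ρ)) :=
    h1.comp_measurePreserving measurePreserving_snd
  have hm : Measurable fun p : (Fin (S + 1) → ℝ) × (Fin (S + 1) → ℝ) => p.1 k ^ σ * p.2 k := by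
    fun_prop
  refine h2.of_le hm.aestronglyMeasurable ?_
  have hae : ∀ᵐ p ∂((urnDirichlet S).prod (Measure.pi ρ)),
      (∀ k, 0 ≤ p.1 k) ∧ ∑ k, p.1 k = 1 :=
    Measure.quasiMeasurePreserving_fst.ae (ae_dirichletMeasure S fun _ => 1 / (S : ℝ))
  filter_upwards [hae] with p hp
  obtain ⟨h3, h4⟩ := rpow_mem_unit_of_simplex hp hσ k
  rw [norm_mul, Real.norm_of_nonneg h3]
  exact mul_le_of_le_one_left (norm_nonneg _) h4

theorem integral_weighted_coordinate {S : ℕ} (hS : 0 < S) {σ : ℝ} (hσ : 0 ≤ σ)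
    (ρ : Fin (S + 1) → Measure ℝ) [∀ k, IsProbabilityMeasure (ρ k)] (k : Fin (S + 1)) :
    ∫ p, p.1 k ^ σ * p.2 k ∂((urnDirichlet S).prod (Measure.pi ρ)) =
      1 / (1 + σ * S) * ∫ x, x ∂(ρ k) := by
  have := isProbabilityMeasure_urnDirichlet hS
  rw [integral_prod_mul (fun y : Fin (S + 1) → ℝ => y k ^ σ) (fun z : Fin (S + 1) → ℝ => z k),
    integral_urnDirichlet_rpow hS k hσ]
  congr 1
  exact integral_comp_eval (i := k) (μ := ρ) (f := fun x : ℝ => x) (by fun_prop)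

theorem sum_ite_lt {S r : ℕ} (hr : r ≤ S + 1) (x y : ℝ) :
    ∑ k : Fin (S + 1), (if (k : ℕ) < r then x else y) = r * x + (S + 1 - r) * y := by
  rw [Fin.sum_univ_eq_sum_range (fun k => if k < r then x else y) (S + 1),
    ← Finset.sum_range_add_sum_Ico _ hr]
  rw [Finset.sum_congr rfl (g := fun _ => x) (fun k hk => if_pos (Finset.mem_range.1 hk)),
    Finset.sum_congr rfl (g := fun _ => y)
      (fun k hk => if_neg (not_lt.2 (Finset.mem_Ico.1 hk).1))]
  simp [Nat.cast_sub hr]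

theorem smoothingLaw_mem_M2 {S : ℕ} (hS : 0 < S) {σ : ℝ} (hσ : 0 ≤ σ) {r : ℕ} (hr : r ≤ S + 1)
    {B C : ℝ} {μ ν : Measure ℝ} (hμ : μ ∈ M2 B) (hν : ν ∈ M2 C) :
    smoothingLaw S σ r μ ν ∈ M2 (1 / (1 + σ * S) * (r * B + (S + 1 - r) * C)) := by
  obtain ⟨hμ1, hμ2, hμ3⟩ := hμ
  obtain ⟨hν1, hν2, hν3⟩ := hν
  set ρ : Fin (S + 1) → Measure ℝ := fun k => if (k : ℕ) < r then μ else ν with hρ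
  have hL : ∀ k, MemLp (fun x : ℝ => x) 2 (ρ k) := fun k => by
    simp only [hρ]; split_ifs <;> assumption
  have hi : ∀ k, ∫ x, x ∂(ρ k) = if (k : ℕ) < r then B else C := fun k => by
    simp only [hρ]; split_ifs <;> assumption
  have hsum := memLp_finsetSum Finset.univ fun k _ => memLp_weighted_coordinate hS hσ ρ k (hL k)
  have hmeas := measurable_weightedSum S σ
  refine ⟨isProbabilityMeasure_smoothingLaw hS σ r μ ν, ?_, ?_⟩
  · exact (memLp_map_measure_iff (by fun_prop) hmeas.aemeasurable).2 hsum
  · rw [smoothingLaw, integral_map hmeas.aemeasurable (by fun_prop)]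
    have := isProbabilityMeasure_urnDirichlet hS
    rw [integral_finsetSum _ fun k _ =>
      (memLp_weighted_coordinate hS hσ ρ k (hL k)).integrable one_le_two]
    simp_rw [integral_weighted_coordinate hS hσ ρ, hi]
    rw [← Finset.mul_sum, sum_ite_lt hr]

/-! ### The Wasserstein distance -/

/-- The quadratic cost of a coupling. -/
def couplingCost (π : Measure (ℝ × ℝ)) : ℝ≥0∞ := ∫⁻ z, ENNReal.ofReal ((z.1 - z.2) ^ 2) ∂π

theorem wasserstein2_le_of_coupling {μ₁ μ₂ : Measure ℝ} {π : Measure (ℝ × ℝ)}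
    (h1 : π.map Prod.fst = μ₁) (h2 : π.map Prod.snd = μ₂) :
    wasserstein2 μ₁ μ₂ ≤ couplingCost π ^ (1 / 2 : ℝ) :=
  iInf₂_le (α := ℝ≥0∞) π ⟨h1, h2⟩

theorem exists_coupling_of_wasserstein2_lt {μ₁ μ₂ : Measure ℝ} {D : ℝ≥0∞}
    (h : wasserstein2 μ₁ μ₂ < D) :
    ∃ π : Measure (ℝ × ℝ), π.map Prod.fst = μ₁ ∧ π.map Prod.snd = μ₂ ∧
      couplingCost π ^ (1 / 2 : ℝ) < D := by
  simp only [wasserstein2, iInf_lt_iff] at h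
  obtain ⟨π, ⟨h1, h2⟩, h3⟩ := h
  exact ⟨π, h1, h2, h3⟩

section Coupling

variable {B : ℝ} {μ₁ μ₂ : Measure ℝ} {π : Measure (ℝ × ℝ)}

theorem isProbabilityMeasure_of_map {X Y : Type*} [MeasurableSpace X] [MeasurableSpace Y]
    {π : Measure X} {f : X → Y} (hf : Measurable f) {μ : Measure Y} [IsProbabilityMeasure μ]
    (h : π.map f = μ) : IsProbabilityMeasure π :=
  ⟨by rw [← Set.preimage_univ (f := f), ← Measure.map_apply hf .univ, h, measure_univ]⟩

theorem memLp_fst_of_coupling (hμ : MemLp (fun x : ℝ => x) 2 μ₁) (h1 : π.map Prod.fst = μ₁) :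
    MemLp (fun z : ℝ × ℝ => z.1) 2 π :=
  (memLp_map_measure_iff (by fun_prop) measurable_fst.aemeasurable).1 (h1 ▸ hμ)

theorem memLp_snd_of_coupling (hμ : MemLp (fun x : ℝ => x) 2 μ₂) (h2 : π.map Prod.snd = μ₂) :
    MemLp (fun z : ℝ × ℝ => z.2) 2 π :=
  (memLp_map_measure_iff (by fun_prop) measurable_snd.aemeasurable).1 (h2 ▸ hμ)

/-- Equality of the two means is what centres the difference and later removes the cross terms. -/
theorem coupling_sub (hμ₁ : μ₁ ∈ M2 B) (hμ₂ : μ₂ ∈ M2 B) (h1 : π.map Prod.fst = μ₁)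
    (h2 : π.map Prod.snd = μ₂) :
    IsProbabilityMeasure π ∧ MemLp (fun z : ℝ × ℝ => z.1 - z.2) 2 π ∧
      ∫ z, (z.1 - z.2) ∂π = 0 := by
  obtain ⟨p1, l1, e1⟩ := hμ₁
  obtain ⟨p2, l2, e2⟩ := hμ₂
  have hp := isProbabilityMeasure_of_map measurable_fst h1
  have m1 := memLp_fst_of_coupling l1 h1
  have m2 := memLp_snd_of_coupling l2 h2
  refine ⟨hp, m1.sub m2, ?_⟩
  rw [integral_sub (m1.integrable one_le_two) (m2.integrable one_le_two)]
  rw [← h1, integral_map measurable_fst.aemeasurable (by fun_prop)] at e1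
  rw [← h2, integral_map measurable_snd.aemeasurable (by fun_prop)] at e2
  rw [e1, e2, sub_self]

end Coupling

/-- The coupling of the two images shares the weights `V` and draws independent pairs from `π` or
`θ`. It need not be optimal: its cost already bounds the distance. -/
theorem wasserstein2_smoothingLaw_le {S : ℕ} (hS : 0 < S) {σ : ℝ} (hσ : 0 ≤ σ) (r : ℕ) {B C : ℝ}
    {μ₁ μ₂ ν₁ ν₂ : Measure ℝ} (hμ₁ : μ₁ ∈ M2 B) (hμ₂ : μ₂ ∈ M2 B) (hν₁ : ν₁ ∈ M2 C)
    (hν₂ : ν₂ ∈ M2 C) {π θ : Measure (ℝ × ℝ)} (hπ₁ : π.map Prod.fst = μ₁)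
    (hπ₂ : π.map Prod.snd = μ₂) (hθ₁ : θ.map Prod.fst = ν₁) (hθ₂ : θ.map Prod.snd = ν₂) :
    wasserstein2 (smoothingLaw S σ r μ₁ ν₁) (smoothingLaw S σ r μ₂ ν₂) ≤
      ENNReal.ofReal (Real.sqrt (((S : ℝ) + 1) / (2 * σ * S + 1))) *
        max (couplingCost π ^ (1 / 2 : ℝ)) (couplingCost θ ^ (1 / 2 : ℝ)) := by
  have := isProbabilityMeasure_urnDirichlet hS
  obtain ⟨pπ, Lπ, Eπ⟩ := coupling_sub hμ₁ hμ₂ hπ₁ hπ₂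
  obtain ⟨pθ, Lθ, Eθ⟩ := coupling_sub hν₁ hν₂ hθ₁ hθ₂
  set ρ : Fin (S + 1) → Measure (ℝ × ℝ) := fun k => if (k : ℕ) < r then π else θ with hρ
  have hpρ : ∀ k, IsProbabilityMeasure (ρ k) := fun k => isProbabilityMeasure_ite _ _ _
  set f : (Fin (S + 1) → ℝ) × (Fin (S + 1) → ℝ × ℝ) → ℝ × ℝ :=
    fun p => (∑ k, p.1 k ^ σ * (p.2 k).1, ∑ k, p.1 k ^ σ * (p.2 k).2) with hf
  have hfm : Measurable f := by fun_prop
  have hproj : ∀ (g : ℝ × ℝ → ℝ) (_ : Measurable g) (μ ν : Measure ℝ), π.map g = μ → θ.map g = ν →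
      ((urnDirichlet S).prod (Measure.pi ρ)).map (fun p => ∑ k, p.1 k ^ σ * g (p.2 k)) =
        smoothingLaw S σ r μ ν := by
    intro g hg μ ν h1 h2
    have hpi : (Measure.pi ρ).map (fun z k => g (z k)) =
        Measure.pi (fun k : Fin (S + 1) => if (k : ℕ) < r then μ else ν) := by
      rw [Measure.pi_map_pi (f := fun _ => g) (hμ := fun k => ?_) (fun k => hg.aemeasurable)]
      · congr 1 with k : 1
        simp only [hρ]; split_ifs <;> assumption
      · have := Measure.isProbabilityMeasure_map (μ := ρ k) hg.aemeasurable
        infer_instance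
    have hgm : Measurable (fun (z : Fin (S + 1) → ℝ × ℝ) k => g (z k)) := by fun_prop
    rw [smoothingLaw, ← hpi, ← Measure.map_id (μ := urnDirichlet S),
      Measure.map_id (μ := urnDirichlet S)]
    -- The Dirichlet factor is written as its own image under the identity so that the product of
    -- the two images becomes the image of a product.
    conv_rhs => rw [← Measure.map_id (μ := dirichletMeasure S fun _ => 1 / (S : ℝ))]
    rw [Measure.map_prod_map _ _ measurable_id hgm, Measure.map_map (measurable_weightedSum S σ)
      (measurable_id.prodMap hgm)]
    rfl
  have h1 : (((urnDirichlet S).prod (Measure.pi ρ)).map f).map Prod.fst =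
      smoothingLaw S σ r μ₁ ν₁ := by
    rw [Measure.map_map measurable_fst hfm]
    exact hproj _ measurable_fst _ _ hπ₁ hθ₁
  have h2 : (((urnDirichlet S).prod (Measure.pi ρ)).map f).map Prod.snd =
      smoothingLaw S σ r μ₂ ν₂ := by
    rw [Measure.map_map measurable_snd hfm]
    exact hproj _ measurable_snd _ _ hπ₂ hθ₂
  refine (wasserstein2_le_of_coupling h1 h2).trans ?_
  set M := max (couplingCost π) (couplingCost θ) with hM
  have hcost : couplingCost (((urnDirichlet S).prod (Measure.pi ρ)).map f) ≤
      ENNReal.ofReal (((S : ℝ) + 1) / (2 * σ * S + 1)) * M := by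
    rw [couplingCost, lintegral_map (by fun_prop) hfm]
    have hpt : ∀ p, (f p).1 - (f p).2 = ∑ k, p.1 k ^ σ * ((p.2 k).1 - (p.2 k).2) := by
      intro p; simp only [hf, mul_sub, Finset.sum_sub_distrib]
    simp_rw [hpt]
    rw [lintegral_sq_weightedSum hS hσ ρ (D := fun z : ℝ × ℝ => z.1 - z.2) (by fun_prop)
      (fun k => by simp only [hρ]; split_ifs <;> assumption)
      (fun k => by simp only [hρ]; split_ifs <;> assumption)]
    have hk : ∀ k ∈ (Finset.univ : Finset (Fin (S + 1))),
        ∫⁻ x, ENNReal.ofReal ((x.1 - x.2) ^ 2) ∂(ρ k) ≤ M := by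
      intro k _
      simp only [hρ]; split_ifs
      · exact le_max_left _ _
      · exact le_max_right _ _
    calc _ ≤ ENNReal.ofReal (1 / (1 + 2 * σ * S)) * ∑ _k : Fin (S + 1), M := by
          gcongr with k hk'; exact hk k hk'
      _ = _ := by
          rw [Finset.sum_const, Finset.card_univ, Fintype.card_fin, nsmul_eq_mul, ← mul_assoc]
          congr 1
          rw [← ENNReal.ofReal_natCast, ← ENNReal.ofReal_mul (by positivity)]
          congr 1
          push_cast
          rw [add_comm (2 * σ * S)]; ring
  calc _ ≤ (ENNReal.ofReal (((S : ℝ) + 1) / (2 * σ * S + 1)) * M) ^ (1 / 2 : ℝ) := by gcongr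
    _ = _ := by
      rw [ENNReal.mul_rpow_of_nonneg _ _ (by norm_num),
        ENNReal.ofReal_rpow_of_nonneg (by positivity) (by norm_num), ← Real.sqrt_eq_rpow]
      congr 1
      exact (ENNReal.monotone_rpow_of_nonneg (by norm_num : (0 : ℝ) ≤ 1 / 2)).map_max

/-- No optimal coupling is needed. For every `D` above the distance there are couplings of cost
below `D`, and the same two couplings serve both components of the transform; then `D` decreases to
the distance. -/
theorem pairDist_smoothingTransform_le {a c S : ℕ} (hS : 0 < S) {σ : ℝ} (hσ : 0 ≤ σ) {B C : ℝ}
    {p q : Measure ℝ × Measure ℝ} (hp : p ∈ M2 B ×ˢ M2 C) (hq : q ∈ M2 B ×ˢ M2 C) :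
    pairDist (smoothingTransform a c S σ p) (smoothingTransform a c S σ q) ≤
      ENNReal.ofReal (Real.sqrt (((S : ℝ) + 1) / (2 * σ * S + 1))) * pairDist p q := by
  set κ := ENNReal.ofReal (Real.sqrt (((S : ℝ) + 1) / (2 * σ * S + 1))) with hκ
  have hκ0 : κ ≠ 0 := by
    have : 0 < Real.sqrt (((S : ℝ) + 1) / (2 * σ * S + 1)) := Real.sqrt_pos.2 (by positivity)
    simpa [hκ] using this
  rw [mul_comm, ← ENNReal.div_le_iff hκ0 ENNReal.ofReal_ne_top]
  refine le_of_forall_gt_imp_ge_of_dense fun D hD => ?_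
  rw [ENNReal.div_le_iff hκ0 ENNReal.ofReal_ne_top, mul_comm]
  obtain ⟨h1, h2⟩ := max_lt_iff.1 hD
  obtain ⟨π, hπ₁, hπ₂, hπ⟩ := exists_coupling_of_wasserstein2_lt h1
  obtain ⟨θ, hθ₁, hθ₂, hθ⟩ := exists_coupling_of_wasserstein2_lt h2
  have key := fun r => wasserstein2_smoothingLaw_le hS hσ r hp.1 hq.1 hp.2 hq.2 hπ₁ hπ₂ hθ₁ hθ₂
  exact max_le ((key (a + 1)).trans (by gcongr; exact (max_lt hπ hθ).le))
    ((key c).trans (by gcongr; exact (max_lt hπ hθ).le))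

/-- The independent coupling has finite cost. Finiteness matters because in `ℝ≥0∞` an inequality `d
≤ κ * d` with `κ < 1` forces `d = 0` only when `d ≠ ⊤`. -/
theorem wasserstein2_ne_top {B : ℝ} {μ₁ μ₂ : Measure ℝ} (h1 : μ₁ ∈ M2 B) (h2 : μ₂ ∈ M2 B) :
    wasserstein2 μ₁ μ₂ ≠ ⊤ := by
  have p1 := h1.1
  have p2 := h2.1
  have e1 : (μ₁.prod μ₂).map Prod.fst = μ₁ := by simp
  have e2 : (μ₁.prod μ₂).map Prod.snd = μ₂ := by simp
  refine ne_top_of_le_ne_top ?_ (wasserstein2_le_of_coupling e1 e2)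
  refine ENNReal.rpow_ne_top_of_nonneg (by norm_num) ?_
  obtain ⟨_, hL, -⟩ := coupling_sub h1 h2 e1 e2
  rw [couplingCost, ← ofReal_integral_eq_lintegral_ofReal hL.integrable_sq
    (ae_of_all _ fun z => sq_nonneg _)]
  exact ENNReal.ofReal_ne_top

theorem norm_charFun_map_sub_le {Ω : Type*} [MeasurableSpace Ω] {P : Measure Ω}
    [IsProbabilityMeasure P] {X Y : Ω → ℝ} (hX : AEMeasurable X P) (hY : AEMeasurable Y P)
    (hXY : Integrable (fun ω => X ω - Y ω) P) (t : ℝ) :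
    ‖charFun (P.map X) t - charFun (P.map Y) t‖ ≤ |t| * ∫ ω, |X ω - Y ω| ∂P := by
  have hi : ∀ {Z : Ω → ℝ}, AEMeasurable Z P →
      Integrable (fun ω => Complex.exp ((t * Z ω : ℝ) * Complex.I)) P := fun {Z} hZ => by
    refine Integrable.of_bound (C := 1) (by fun_prop) (ae_of_all _ fun p => ?_)
    rw [Complex.norm_exp_ofReal_mul_I]
  rw [charFun_apply_real, charFun_apply_real, integral_map hX (by fun_prop),
    integral_map hY (by fun_prop)]
  simp_rw [← Complex.ofReal_mul]
  rw [← integral_sub (hi hX) (hi hY), ← integral_const_mul]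
  refine norm_integral_le_of_norm_le (hXY.abs.const_mul _) (ae_of_all _ fun ω => ?_)
  have h : Complex.exp ((t * X ω : ℝ) * Complex.I) - Complex.exp ((t * Y ω : ℝ) * Complex.I) =
      Complex.exp ((t * Y ω : ℝ) * Complex.I) *
        (Complex.exp (Complex.I * (t * (X ω - Y ω) : ℝ)) - 1) := by
    rw [mul_sub, ← Complex.exp_add, mul_one]
    congr 2
    push_cast
    ring
  rw [h, norm_mul, Complex.norm_exp_ofReal_mul_I, one_mul]
  exact (Real.norm_exp_I_mul_ofReal_sub_one_le).trans (by rw [Real.norm_eq_abs, abs_mul])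

/-- Under any coupling the characteristic functions at `t` differ by at most `|t| E|X₁ - X₂|`, which
is at most `|t|` times the square root of the quadratic cost. Couplings of arbitrarily small cost
therefore identify the two laws. -/
theorem eq_of_wasserstein2_eq_zero {B : ℝ} {μ₁ μ₂ : Measure ℝ} (h1 : μ₁ ∈ M2 B) (h2 : μ₂ ∈ M2 B)
    (h : wasserstein2 μ₁ μ₂ = 0) : μ₁ = μ₂ := by
  have p1 := h1.1
  have p2 := h2.1
  refine Measure.ext_of_charFun (funext fun t => ?_)
  rw [← sub_eq_zero, ← norm_le_zero_iff]
  refine le_of_forall_pos_le_add fun ε hε => ?_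
  -- The added one keeps the denominator positive at `t = 0`.
  have hε' : 0 < ε / (|t| + 1) := by positivity
  obtain ⟨π, e1, e2, hπ⟩ := exists_coupling_of_wasserstein2_lt
    (h.trans_lt (ENNReal.ofReal_pos.2 hε'))
  obtain ⟨pπ, hL, -⟩ := coupling_sub h1 h2 e1 e2
  have hI : ∫ z, |z.1 - z.2| ∂π ≤ ε / (|t| + 1) := by
    -- Cauchy–Schwarz, read off from the nonnegativity of the variance of `|z.1 - z.2|`.
    have hsq : (∫ z, |z.1 - z.2| ∂π) ^ 2 ≤ ∫ z, (z.1 - z.2) ^ 2 ∂π := by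
      have hv := ProbabilityTheory.variance_nonneg (fun z : ℝ × ℝ => |z.1 - z.2|) π
      rw [ProbabilityTheory.variance_eq_sub (X := fun z : ℝ × ℝ => |z.1 - z.2|) hL.abs] at hv
      simp only [Pi.pow_apply, sq_abs] at hv
      linarith
    have hc : couplingCost π = ENNReal.ofReal (∫ z, (z.1 - z.2) ^ 2 ∂π) :=
      (ofReal_integral_eq_lintegral_ofReal hL.integrable_sq
        (ae_of_all _ fun z => sq_nonneg _)).symm
    have h0 : 0 ≤ ∫ z, (z.1 - z.2) ^ 2 ∂π := integral_nonneg fun z => sq_nonneg _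
    rw [hc, ENNReal.ofReal_rpow_of_nonneg h0 (by norm_num), ← Real.sqrt_eq_rpow,
      ENNReal.ofReal_lt_ofReal_iff hε'] at hπ
    exact (Real.le_sqrt_of_sq_le hsq).trans hπ.le
  rw [← e1, ← e2, zero_add]
  refine (norm_charFun_map_sub_le measurable_fst.aemeasurable measurable_snd.aemeasurable
    (hL.integrable one_le_two) t).trans ?_
  calc |t| * ∫ z, |z.1 - z.2| ∂π ≤ (|t| + 1) * (ε / (|t| + 1)) := by
        gcongr
        linarith
    _ = ε := by field_simp

/-! ### Uniqueness and homogeneity of solutions of the system -/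

theorem lipschitzConst_lt_one {S m : ℕ} (hlarge : S < 2 * m) :
    Real.sqrt (((S : ℝ) + 1) / (2 * (m : ℝ) + 1)) < 1 := by
  have : (S : ℝ) < 2 * m := by exact_mod_cast hlarge
  rw [Real.sqrt_lt' one_pos, one_pow, div_lt_one (by positivity)]
  linarith

theorem IsSystemSolution.unique {a c S m : ℕ} (hS : 0 < S) (hlarge : S < 2 * m) {B C : ℝ}
    {p q : Measure ℝ × Measure ℝ} (hp : p ∈ M2 B ×ˢ M2 C) (hq : q ∈ M2 B ×ˢ M2 C)
    (hps : IsSystemSolution a c S ((m : ℝ) / S) p) (hqs : IsSystemSolution a c S ((m : ℝ) / S) q) :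
    p = q := by
  have hS' : (S : ℝ) ≠ 0 := by positivity
  have hfp : ∀ {p}, IsSystemSolution a c S ((m : ℝ) / S) p →
      smoothingTransform a c S ((m : ℝ) / S) p = p := fun h => Prod.ext h.1.symm h.2.symm
  have h := pairDist_smoothingTransform_le (a := a) (c := c) hS
    (by positivity : 0 ≤ (m : ℝ) / S) hp hq
  rw [hfp hps, hfp hqs, show 2 * ((m : ℝ) / S) * S + 1 = 2 * m + 1 by field_simp] at h
  have hlt : ENNReal.ofReal (Real.sqrt (((S : ℝ) + 1) / (2 * (m : ℝ) + 1))) < 1 := by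
    rw [← ENNReal.ofReal_one]
    exact (ENNReal.ofReal_lt_ofReal_iff one_pos).2 (lipschitzConst_lt_one hlarge)
  have hfin : pairDist p q ≠ ⊤ :=
    (max_lt (wasserstein2_ne_top hp.1 hq.1).lt_top (wasserstein2_ne_top hp.2 hq.2).lt_top).ne
  have h0 : pairDist p q = 0 := by
    by_contra hne
    have := ENNReal.mul_lt_mul_left hne hfin hlt
    rw [one_mul] at this
    exact absurd h this.not_ge
  have h1 : wasserstein2 p.1 q.1 = 0 := le_antisymm ((le_max_left _ _).trans h0.le) zero_le
  have h2 : wasserstein2 p.2 q.2 = 0 := le_antisymm ((le_max_right _ _).trans h0.le) zero_le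
  exact Prod.ext (eq_of_wasserstein2_eq_zero hp.1 hq.1 h1) (eq_of_wasserstein2_eq_zero hp.2 hq.2 h2)

theorem map_mul_mem_M2 {B : ℝ} {μ : Measure ℝ} (hμ : μ ∈ M2 B) (l : ℝ) :
    μ.map (l * ·) ∈ M2 (l * B) := by
  obtain ⟨h1, h2, h3⟩ := hμ
  have hm : Measurable (l * · : ℝ → ℝ) := by fun_prop
  refine ⟨Measure.isProbabilityMeasure_map hm.aemeasurable, ?_, ?_⟩
  · exact (memLp_map_measure_iff (by fun_prop) hm.aemeasurable).2 (h2.const_mul l)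
  · rw [integral_map hm.aemeasurable (by fun_prop), integral_const_mul, h3]

/-- The smoothing sum is linear in the `X` and `Y` variables for fixed `V`, so a common dilation
passes through it. This carries one solution to all admissible pairs of means. -/
theorem smoothingLaw_map_mul {S : ℕ} (hS : 0 < S) (σ : ℝ) (r : ℕ) (μ ν : Measure ℝ)
    [IsProbabilityMeasure μ] [IsProbabilityMeasure ν] (l : ℝ) :
    smoothingLaw S σ r (μ.map (l * ·)) (ν.map (l * ·)) =
      (smoothingLaw S σ r μ ν).map (l * ·) := by
  have hm : Measurable (l * · : ℝ → ℝ) := by fun_prop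
  have p1 := Measure.isProbabilityMeasure_map (μ := μ) hm.aemeasurable
  have p2 := Measure.isProbabilityMeasure_map (μ := ν) hm.aemeasurable
  have p3 := isProbabilityMeasure_smoothingLaw hS σ r μ ν
  have p4 := isProbabilityMeasure_smoothingLaw hS σ r (μ.map (l * ·)) (ν.map (l * ·))
  have p5 := Measure.isProbabilityMeasure_map (μ := smoothingLaw S σ r μ ν) hm.aemeasurable
  refine Measure.ext_of_charFun (funext fun t => ?_)
  rw [charFun_map_mul, charFun_smoothingLaw hS, charFun_smoothingLaw hS]
  congr 1 with V
  refine Finset.prod_congr rfl fun k _ => ?_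
  split_ifs <;> rw [charFun_map_mul, mul_assoc]

theorem IsSystemSolution.map_mul {a c S : ℕ} (hS : 0 < S) {σ : ℝ} {p : Measure ℝ × Measure ℝ}
    (h1 : IsProbabilityMeasure p.1) (h2 : IsProbabilityMeasure p.2)
    (hp : IsSystemSolution a c S σ p) (l : ℝ) :
    IsSystemSolution a c S σ (p.1.map (l * ·), p.2.map (l * ·)) :=
  ⟨by simpa [smoothingLaw_map_mul hS] using congrArg (Measure.map (l * ·)) hp.1,
    by simpa [smoothingLaw_map_mul hS] using congrArg (Measure.map (l * ·)) hp.2⟩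

/-! ### Growth of the normalizing sequence -/

/-- The ratio `∏_{j < n} (1 + m + j S) / (1 + j S)`. -/
def urnGrowth (S m n : ℕ) : ℝ := rising S (1 + m) n / rising S 1 n

theorem urnGrowth_pos (S m n : ℕ) : 0 < urnGrowth S m n :=
  div_pos (rising_pos S (by positivity) n) (rising_pos S one_pos n)

theorem urnGrowth_succ (S m n : ℕ) :
    urnGrowth S m (n + 1) = urnGrowth S m n * (1 + m / (1 + n * S)) := by
  have h1 := rising_pos S one_pos n
  have h2 : (0 : ℝ) < 1 + n * S := by positivity
  rw [urnGrowth, urnGrowth, rising_succ, rising_succ]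
  field_simp
  ring

/-- Euler's product for the Gamma function. `Real.GammaSeq x n` has the `n + 1` factors `x, …, x +
n` in its denominator, whence the index `n + 1`. -/
theorem rising_eq_div_GammaSeq {S : ℕ} (hS : 0 < S) {τ : ℝ} (hτ : 0 < τ) {n : ℕ} (hn : 0 < n) :
    rising S τ (n + 1) * Real.GammaSeq (τ / S) n =
      (S : ℝ) ^ (n + 1) * ((n : ℝ) ^ (τ / S) * n.factorial) := by
  have hS' : (0 : ℝ) < S := by exact_mod_cast hS
  have h : rising S τ (n + 1) = (S : ℝ) ^ (n + 1) * ∏ j ∈ Finset.range (n + 1), (τ / S + j) := by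
    have hc := Finset.prod_const (s := Finset.range (n + 1)) (S : ℝ)
    rw [Finset.card_range] at hc
    rw [rising, ← hc, ← Finset.prod_mul_distrib]
    exact Finset.prod_congr rfl fun j _ => by field_simp
  have h0 : ∏ j ∈ Finset.range (n + 1), (τ / S + j) ≠ 0 :=
    (Finset.prod_pos fun j _ => by positivity).ne'
  rw [h, Real.GammaSeq]
  field_simp

theorem tendsto_urnGrowth_div_rpow {S : ℕ} (hS : 0 < S) (m : ℕ) :
    Tendsto (fun n : ℕ => urnGrowth S m n / (n : ℝ) ^ ((m : ℝ) / S)) atTop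
      (𝓝 (Real.Gamma (1 / (S : ℝ)) / Real.Gamma (((m : ℝ) + 1) / S))) := by
  have hS' : (0 : ℝ) < S := by exact_mod_cast hS
  have hG : Real.Gamma (((m : ℝ) + 1) / S) ≠ 0 := (Real.Gamma_pos_of_pos (by positivity)).ne'
  have h1 := (Real.GammaSeq_tendsto_Gamma (1 / (S : ℝ))).div
    (Real.GammaSeq_tendsto_Gamma (((m : ℝ) + 1) / S)) hG
  -- Euler's sequence at `n` describes the growth at `n + 1`; this factor converts `n ^ σ` into `(n
  -- + 1) ^ σ`.
  have h2 : Tendsto (fun n : ℕ => ((n : ℝ) / ((n : ℝ) + 1)) ^ ((m : ℝ) / S)) atTop (𝓝 1) := by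
    have := (tendsto_natCast_div_add_atTop (1 : ℝ)).rpow_const (p := (m : ℝ) / S)
      (Or.inl one_ne_zero)
    simpa using this
  have h3 := h1.mul h2
  rw [mul_one] at h3
  refine (tendsto_add_atTop_iff_nat 1).1 (h3.congr' ?_)
  filter_upwards [eventually_gt_atTop 0] with n hn
  have hn' : (0 : ℝ) < n := by exact_mod_cast hn
  have e1 := rising_eq_div_GammaSeq hS one_pos hn
  have e2 := rising_eq_div_GammaSeq hS (show (0 : ℝ) < m + 1 by positivity) hn
  have r1 := rising_pos S one_pos (n + 1)
  have r2 := rising_pos S (show (0 : ℝ) < m + 1 by positivity) (n + 1)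
  have g2 : Real.GammaSeq (((m : ℝ) + 1) / S) n ≠ 0 := by
    intro h0
    rw [h0, mul_zero] at e2
    have : (0 : ℝ) < (S : ℝ) ^ (n + 1) * ((n : ℝ) ^ (((m : ℝ) + 1) / S) * n.factorial) := by
      positivity
    linarith
  have e3 : (n : ℝ) ^ (((m : ℝ) + 1) / S) = (n : ℝ) ^ ((m : ℝ) / S) * (n : ℝ) ^ (1 / (S : ℝ)) := by
    rw [← Real.rpow_add hn']; congr 1; field_simp
  have e4 : Real.GammaSeq (1 / S) n * (n : ℝ) ^ ((m : ℝ) / S) * rising S 1 (n + 1) =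
      rising S (m + 1) (n + 1) * Real.GammaSeq ((m + 1) / S) n := by
    rw [e2, e3]; linear_combination (n : ℝ) ^ ((m : ℝ) / S) * e1
  have p1 : (0 : ℝ) < (n : ℝ) ^ ((m : ℝ) / S) := by positivity
  have p2 : (0 : ℝ) < ((n : ℝ) + 1) ^ ((m : ℝ) / S) := by positivity
  simp only [Pi.div_apply, urnGrowth]
  rw [Real.div_rpow hn'.le (by positivity), Nat.cast_succ, add_comm (1 : ℝ) (m : ℝ)]
  field_simp
  linear_combination e4

/-- The terms are of order `n ^ (-2σ)`. The urn martingale is bounded in `L²` because `2σ > 1` here.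
-/
theorem summable_inv_urnGrowth_sq {S m : ℕ} (hS : 0 < S) (hlarge : S < 2 * m) :
    Summable (fun n : ℕ => 1 / urnGrowth S m n ^ 2) := by
  have hS' : (0 : ℝ) < S := by exact_mod_cast hS
  have hl' : (S : ℝ) < 2 * m := by exact_mod_cast hlarge
  set L := Real.Gamma (1 / (S : ℝ)) / Real.Gamma (((m : ℝ) + 1) / S) with hL
  have hLpos : 0 < L := div_pos (Real.Gamma_pos_of_pos (by positivity))
    (Real.Gamma_pos_of_pos (by positivity))
  have hsum : Summable fun n : ℕ => 1 / (n : ℝ) ^ (2 * ((m : ℝ) / S)) := by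
    rw [Real.summable_one_div_nat_rpow]
    rw [← mul_div_assoc, lt_div_iff₀ hS']; linarith
  refine summable_of_isBigO_nat hsum ?_
  refine Asymptotics.IsBigO.of_bound ((L / 2) ^ 2)⁻¹ ?_
  filter_upwards [(tendsto_urnGrowth_div_rpow hS m).eventually_const_lt (half_lt_self hLpos),
    eventually_gt_atTop 0] with n hn hn0
  have hn' : (0 : ℝ) < n := by exact_mod_cast hn0
  have hp : (0 : ℝ) < (n : ℝ) ^ ((m : ℝ) / S) := by positivity
  rw [lt_div_iff₀ hp] at hn
  rw [Real.norm_of_nonneg (by positivity), Real.norm_of_nonneg (by positivity),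
    mul_comm (2 : ℝ), Real.rpow_mul hn'.le, Real.rpow_two, ← one_div, one_div_mul_one_div,
    ← mul_pow]
  gcongr

/-! ### The Markov property of the urn -/

section Markov

variable {E : Type*} [NormedAddCommGroup E] [NormedSpace ℝ E]

/-- The generator of the urn: `g ↦ x g (x + a, y + b) + y g (x + c, y + d)`. -/
def urnGenerator (a b c d : ℕ) (g : ℕ × ℕ → E) (x : ℕ × ℕ) : E :=
  (x.1 : ℝ) • g (x.1 + a, x.2 + b) + (x.2 : ℝ) • g (x.1 + c, x.2 + d)

/-- The transition operator of the urn. -/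
def urnTransition (a b c d : ℕ) (g : ℕ × ℕ → E) (x : ℕ × ℕ) : E :=
  ((x.1 : ℝ) + x.2)⁻¹ • urnGenerator a b c d g x

variable {Ω : Type*} [MeasurableSpace Ω] {P : Measure Ω} {a b c d : ℕ} {x₀ : ℕ × ℕ}
  {U : ℕ → Ω → ℕ × ℕ}

/-- The trajectory of the process up to time `n`. -/
def urnHistory (U : ℕ → Ω → ℕ × ℕ) (n : ℕ) (ω : Ω) : Fin (n + 1) → ℕ × ℕ := fun i => U i ω

theorem IsPolyaUrn.measurable_history (hU : IsPolyaUrn P a b c d x₀ U) (n : ℕ) :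
    Measurable (urnHistory U n) := measurable_pi_iff.2 fun i => hU.measurable i

/-- This is the conditional law of the next state given the past. The state space is countable, so
it suffices to test singletons, where it is the cylinder formula of the chain. The sum of two Dirac
masses remains correct if both replacements lead to the same composition. -/
theorem IsPolyaUrn.map_restrict_history (hU : IsPolyaUrn P a b c d x₀ U) (n : ℕ)
    (H : Fin (n + 1) → ℕ × ℕ) :
    (P.restrict (urnHistory U n ⁻¹' {H})).map (U (n + 1)) =
      P (urnHistory U n ⁻¹' {H}) • ((((H (Fin.last n)).1 : ℝ≥0∞) /
          ((H (Fin.last n)).1 + (H (Fin.last n)).2)) •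
            Measure.dirac ((H (Fin.last n)).1 + a, (H (Fin.last n)).2 + b) +
        (((H (Fin.last n)).2 : ℝ≥0∞) / ((H (Fin.last n)).1 + (H (Fin.last n)).2)) •
            Measure.dirac ((H (Fin.last n)).1 + c, (H (Fin.last n)).2 + d)) := by
  refine Measure.ext_of_singleton fun y => ?_
  have hms : MeasurableSet (urnHistory U n ⁻¹' {H}) :=
    hU.measurable_history n (measurableSet_singleton _)
  rw [Measure.map_apply (hU.measurable _) (measurableSet_singleton _),
    Measure.restrict_apply (hU.measurable _ (measurableSet_singleton _))]
  -- The path prescribed here is the history `H` up to time `n`, extended by `y`.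
  have key := hU.transition n (fun i => if hi : i < n + 1 then H ⟨i, hi⟩ else y)
  have e1 : {ω | ∀ i ≤ n + 1, U i ω = if hi : i < n + 1 then H ⟨i, hi⟩ else y} =
      U (n + 1) ⁻¹' {y} ∩ urnHistory U n ⁻¹' {H} := by
    ext ω
    simp only [Set.mem_ofPred_eq, Set.mem_inter_iff, Set.mem_preimage, Set.mem_singleton_iff,
      funext_iff, urnHistory]
    constructor
    · intro h
      refine ⟨by simpa using h (n + 1) le_rfl, fun i => ?_⟩
      have := h i (by omega)
      simpa [i.2] using this
    · rintro ⟨h1, h2⟩ i hi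
      split_ifs with h3
      · exact h2 ⟨i, h3⟩
      · rwa [show i = n + 1 by omega]
  have e2 : {ω | ∀ i ≤ n, U i ω = if hi : i < n + 1 then H ⟨i, hi⟩ else y} =
      urnHistory U n ⁻¹' {H} := by
    ext ω
    simp only [Set.mem_ofPred_eq, Set.mem_preimage, Set.mem_singleton_iff, funext_iff, urnHistory]
    constructor
    · intro h i
      have := h i (by omega)
      simpa [i.2] using this
    · intro h2 i hi
      rw [dif_pos (by omega)]
      exact h2 ⟨i, by omega⟩
  rw [e1, e2] at key
  rw [key]
  simp only [urnStep, lt_add_iff_pos_right, zero_lt_one, dite_true, lt_irrefl, dite_false,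
    Measure.smul_apply, Measure.add_apply, Measure.dirac_apply' _ (measurableSet_singleton y),
    smul_eq_mul, Set.indicator, Set.mem_singleton_iff, Pi.one_apply, mul_ite, mul_one, mul_zero,
    eq_comm (a := y)]
  rfl

theorem ENNReal_natCast_div_add_ne_top (x y z : ℕ) (h : x ≤ y + z) :
    (x : ℝ≥0∞) / ((y : ℝ≥0∞) + z) ≠ ⊤ := by
  refine ne_top_of_le_ne_top ENNReal.one_ne_top (ENNReal.div_le_of_le_mul ?_)
  rw [one_mul]; exact_mod_cast h

theorem IsPolyaUrn.setIntegral_cylinder [CompleteSpace E] (hU : IsPolyaUrn P a b c d x₀ U) (n : ℕ)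
    (H : Fin (n + 1) → ℕ × ℕ) (g : ℕ × ℕ → E) :
    ∫ ω in urnHistory U n ⁻¹' {H}, g (U (n + 1) ω) ∂P =
      ∫ ω in urnHistory U n ⁻¹' {H}, urnTransition a b c d g (U n ω) ∂P := by
  have hms : MeasurableSet (urnHistory U n ⁻¹' {H}) :=
    hU.measurable_history n (measurableSet_singleton _)
  rw [← integral_map (hU.measurable (n + 1)).aemeasurable
    (StronglyMeasurable.of_discrete.aestronglyMeasurable), hU.map_restrict_history]
  have h2 : ∀ ω ∈ urnHistory U n ⁻¹' {H}, urnTransition a b c d g (U n ω) =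
      urnTransition a b c d g (H (Fin.last n)) := by
    intro ω hω
    have := congrFun (show urnHistory U n ω = H from hω) (Fin.last n)
    rw [← this]; rfl
  rw [setIntegral_congr_fun hms h2, setIntegral_const, integral_smul_measure,
    integral_add_measure, integral_smul_measure, integral_smul_measure, integral_dirac,
    integral_dirac, urnTransition, urnGenerator]
  · simp only [ENNReal.toReal_div, ENNReal.toReal_natCast]
    rw [ENNReal.toReal_add (by simp) (by simp)]
    simp only [ENNReal.toReal_natCast, div_eq_inv_mul, smul_add, smul_smul]
    rfl
  · exact (integrable_dirac (by simp)).smul_measure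
      (ENNReal_natCast_div_add_ne_top _ _ _ (by omega))
  · exact (integrable_dirac (by simp)).smul_measure
      (ENNReal_natCast_div_add_ne_top _ _ _ (by omega))

theorem IsPolyaUrn.ae_step (hU : IsPolyaUrn P a b c d x₀ U) (n : ℕ) :
    ∀ᵐ ω ∂P, U (n + 1) ω = ((U n ω).1 + a, (U n ω).2 + b) ∨
      U (n + 1) ω = ((U n ω).1 + c, (U n ω).2 + d) := by
  have h : ∀ H : Fin (n + 1) → ℕ × ℕ, ∀ᵐ ω ∂P, ω ∈ urnHistory U n ⁻¹' {H} →
      (U (n + 1) ω = ((H (Fin.last n)).1 + a, (H (Fin.last n)).2 + b) ∨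
        U (n + 1) ω = ((H (Fin.last n)).1 + c, (H (Fin.last n)).2 + d)) := by
    intro H
    have hms : MeasurableSet (urnHistory U n ⁻¹' {H}) :=
      hU.measurable_history n (measurableSet_singleton _)
    rw [← ae_restrict_iff' hms]
    have := (ae_map_iff (μ := P.restrict (urnHistory U n ⁻¹' {H}))
      (hU.measurable (n + 1)).aemeasurable (p := fun y =>
      y = ((H (Fin.last n)).1 + a, (H (Fin.last n)).2 + b) ∨
        y = ((H (Fin.last n)).1 + c, (H (Fin.last n)).2 + d)) (MeasurableSet.of_discrete)).1
    refine this ?_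
    rw [hU.map_restrict_history]
    refine Measure.ae_smul_measure (ae_add_measure_iff.2 ⟨?_, ?_⟩) _
    · refine Measure.ae_smul_measure ?_ _
      rw [ae_dirac_eq]; simp
    · refine Measure.ae_smul_measure ?_ _
      rw [ae_dirac_eq]; simp
  filter_upwards [ae_all_iff.2 h] with ω hω
  exact hω (urnHistory U n ω) rfl

theorem IsPolyaUrn.ae_total {S : ℕ} (hab : a + b = S) (hcd : c + d = S)
    (hU : IsPolyaUrn P a b c d x₀ U) (n : ℕ) :
    ∀ᵐ ω ∂P, (U n ω).1 + (U n ω).2 = x₀.1 + x₀.2 + n * S := by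
  induction n with
  | zero =>
    filter_upwards [hU.initial] with ω hω
    simp [hω]
  | succ n ih =>
    filter_upwards [ih, hU.ae_step n] with ω h1 h2
    rw [add_mul, one_mul]
    rcases h2 with h2 | h2 <;> rw [h2] <;> dsimp only <;> omega

/-- The total number of balls at a given time is deterministic, so almost surely only finitely many
compositions occur and every function of them is bounded. -/
theorem IsPolyaUrn.integrable_comp {F : Type*} [NormedAddCommGroup F] [IsFiniteMeasure P] {S : ℕ}
    (hab : a + b = S) (hcd : c + d = S) (hU : IsPolyaUrn P a b c d x₀ U) (n : ℕ)
    (g : ℕ × ℕ → F) :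
    Integrable (fun ω => g (U n ω)) P := by
  refine Integrable.of_bound
    (C := ∑ x ∈ Finset.range (x₀.1 + x₀.2 + n * S + 1) ×ˢ Finset.range (x₀.1 + x₀.2 + n * S + 1),
      ‖g x‖) ?_ ?_
  · exact ((StronglyMeasurable.of_discrete (f := g)).comp_measurable
      (hU.measurable n)).aestronglyMeasurable
  · filter_upwards [hU.ae_total hab hcd n] with ω hω
    exact Finset.single_le_sum (f := fun x => ‖g x‖) (fun _ _ => norm_nonneg _)
      (by simp only [Finset.mem_product, Finset.mem_range]; omega)

/-- This is the Markov property in conditional-expectation form, obtained by cutting the event into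
countably many cylinders. -/
theorem IsPolyaUrn.setIntegral_history [CompleteSpace E] [IsFiniteMeasure P] {S : ℕ}
    (hab : a + b = S) (hcd : c + d = S) (hU : IsPolyaUrn P a b c d x₀ U) (n : ℕ)
    (B : Set (Fin (n + 1) → ℕ × ℕ)) (g : ℕ × ℕ → E) :
    ∫ ω in urnHistory U n ⁻¹' B, g (U (n + 1) ω) ∂P =
      ∫ ω in urnHistory U n ⁻¹' B, urnTransition a b c d g (U n ω) ∂P := by
  have hB : urnHistory U n ⁻¹' B = ⋃ H : B, urnHistory U n ⁻¹' {H.1} := by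
    ext ω; simp
  have hd : Pairwise (Function.onFun Disjoint fun H : B => urnHistory U n ⁻¹' {H.1}) := by
    intro H H' hne
    refine Disjoint.preimage _ (Set.disjoint_singleton.2 fun h => hne (Subtype.ext h))
  have hm : ∀ H : B, MeasurableSet (urnHistory U n ⁻¹' {H.1}) := fun H =>
    hU.measurable_history n (measurableSet_singleton _)
  rw [hB, integral_iUnion hm hd (hU.integrable_comp hab hcd (n + 1) g).integrableOn,
    integral_iUnion hm hd
      (hU.integrable_comp hab hcd n (urnTransition a b c d g)).integrableOn]
  exact tsum_congr fun H => hU.setIntegral_cylinder n H.1 g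

theorem IsPolyaUrn.integral_succ [CompleteSpace E] [IsFiniteMeasure P] {S : ℕ}
    (hab : a + b = S) (hcd : c + d = S) (hU : IsPolyaUrn P a b c d x₀ U) (n : ℕ)
    (g : ℕ × ℕ → E) :
    ∫ ω, g (U (n + 1) ω) ∂P = ∫ ω, urnTransition a b c d g (U n ω) ∂P := by
  simpa using hU.setIntegral_history hab hcd n Set.univ g

/-- The total before each draw is deterministic, so the normalizing denominators leave the
expectation as one product. What remains is an iterate of the unnormalized generator, to which
generating functions apply. -/
theorem IsPolyaUrn.integral_eq_iterate [CompleteSpace E] [IsProbabilityMeasure P] {S : ℕ}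
    (hab : a + b = S) (hcd : c + d = S) (hU : IsPolyaUrn P a b c d x₀ U) (n : ℕ)
    (g : ℕ × ℕ → E) :
    ∫ ω, g (U n ω) ∂P =
      (rising S (x₀.1 + x₀.2) n)⁻¹ • (urnGenerator a b c d)^[n] g x₀ := by
  induction n generalizing g with
  | zero =>
    rw [integral_congr_ae (g := fun _ => g x₀)]
    · simp [rising]
    · filter_upwards [hU.initial] with ω hω
      rw [hω]
  | succ n ih =>
    rw [hU.integral_succ hab hcd, Function.iterate_succ_apply, rising_succ, mul_inv, mul_comm,
      mul_smul, ← ih, ← integral_smul]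
    refine integral_congr_ae ?_
    filter_upwards [hU.ae_total hab hcd n] with ω hω
    rw [urnTransition]
    congr 2
    exact_mod_cast hω

end Markov

/-! ### Sequences bounded in `L²` -/

section BoundedL2

variable {Ω : Type*} [MeasurableSpace Ω] {P : Measure Ω}

/-- Where `|f| ≥ C` one has `|f| ≤ f ^ 2 / C`, so the tails are at most `K / C` uniformly in `n`. -/
theorem uniformIntegrable_of_integral_sq_le [IsFiniteMeasure P] {f : ℕ → Ω → ℝ}
    (hf : ∀ n, MemLp (f n) 2 P) {K : ℝ} (hK : ∀ n, ∫ ω, f n ω ^ 2 ∂P ≤ K) :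
    UniformIntegrable f 1 P := by
  refine uniformIntegrable_of le_rfl ENNReal.one_ne_top (fun n => (hf n).aestronglyMeasurable) ?_
  intro ε hε
  have hK0 : 0 ≤ K := (integral_nonneg fun ω => sq_nonneg (f 0 ω)).trans (hK 0)
  -- Any positive `C ≥ K / ε` would do; the added one ensures positivity when `K = 0`.
  set C : ℝ := K / ε + 1 with hC
  have hC0 : 0 < C := by positivity
  refine ⟨C.toNNReal, fun n => ?_⟩
  rw [eLpNorm_one_eq_lintegral_enorm]
  calc ∫⁻ ω, ‖({x | C.toNNReal ≤ ‖f n x‖₊}.indicator (f n)) ω‖ₑ ∂P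
      ≤ ∫⁻ ω, ENNReal.ofReal (f n ω ^ 2 / C) ∂P := by
        refine lintegral_mono fun ω => ?_
        by_cases h : ω ∈ {x | C.toNNReal ≤ ‖f n x‖₊}
        · rw [Set.indicator_of_mem h, ← ofReal_norm]
          refine ENNReal.ofReal_le_ofReal ?_
          have h' : C ≤ ‖f n ω‖ := by
            have := Real.toNNReal_le_iff_le_coe.1 (show C.toNNReal ≤ ‖f n ω‖₊ from h)
            simpa using this
          rw [le_div_iff₀ hC0, ← sq_abs, sq, ← Real.norm_eq_abs]
          gcongr
        · rw [Set.indicator_of_notMem h]; simp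
    _ = ENNReal.ofReal (∫ ω, f n ω ^ 2 / C ∂P) :=
        (ofReal_integral_eq_lintegral_ofReal ((hf n).integrable_sq.div_const C)
          (ae_of_all _ fun ω => by positivity)).symm
    _ ≤ ENNReal.ofReal ε := by
        refine ENNReal.ofReal_le_ofReal ?_
        rw [integral_div, div_le_iff₀ hC0]
        refine (hK n).trans ?_
        rw [hC, mul_add, mul_div_cancel₀ _ hε.ne']
        linarith

theorem eLpNorm_two_le_of_integral_sq_le {f : Ω → ℝ} (hf : MemLp f 2 P) {K : ℝ}
    (hK : ∫ ω, f ω ^ 2 ∂P ≤ K) : eLpNorm f 2 P ≤ (Real.sqrt K).toNNReal := by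
  rw [hf.eLpNorm_eq_integral_rpow_norm two_ne_zero ENNReal.ofNat_ne_top]
  refine ENNReal.ofReal_le_ofReal ?_
  simp only [ENNReal.toReal_ofNat, Real.rpow_two, Real.norm_eq_abs, sq_abs]
  rw [← one_div, ← Real.sqrt_eq_rpow]
  exact Real.sqrt_le_sqrt hK

/-- A martingale bounded in `L²` converges almost surely and in `L¹` to a square integrable
variable with the same mean. -/
theorem Martingale.exists_limit_of_integral_sq_le [IsProbabilityMeasure P] {M : ℕ → Ω → ℝ}
    {ℱ : Filtration ℕ ‹MeasurableSpace Ω›} (hM : Martingale M ℱ P) (hL : ∀ n, MemLp (M n) 2 P)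
    {K : ℝ} (hK : ∀ n, ∫ ω, M n ω ^ 2 ∂P ≤ K) :
    ∃ L : Ω → ℝ, (∀ᵐ ω ∂P, Tendsto (fun n => M n ω) atTop (𝓝 (L ω))) ∧ MemLp L 2 P ∧
      Tendsto (fun n => ∫ ω, |M n ω - L ω| ∂P) atTop (𝓝 0) ∧ ∀ n, ∫ ω, L ω ∂P = ∫ ω, M n ω ∂P := by
  have hbd := fun n => eLpNorm_two_le_of_integral_sq_le (hL n) (hK n)
  have hUI := uniformIntegrable_of_integral_sq_le hL hK
  have hLmem : MemLp (Filtration.limitProcess M ℱ P) 2 P :=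
    Filtration.memLp_limitProcess_of_eLpNorm_bdd (fun n => (hL n).aestronglyMeasurable) hbd
  have hsub := hM.submartingale
  have hconv := hsub.tendsto_eLpNorm_one_limitProcess hUI
  have habs : Tendsto (fun n => ∫ ω, |M n ω - Filtration.limitProcess M ℱ P ω| ∂P) atTop (𝓝 0) := by
    have := (ENNReal.tendsto_toReal ENNReal.zero_ne_top).comp hconv
    refine this.congr fun n => ?_
    rw [Function.comp_apply, eLpNorm_one_eq_lintegral_enorm, ← integral_norm_eq_lintegral_enorm]
    · rfl
    · exact (hL n).aestronglyMeasurable.sub hLmem.aestronglyMeasurable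
  refine ⟨Filtration.limitProcess M ℱ P, hsub.ae_tendsto_limitProcess_of_uniformIntegrable hUI, hLmem, habs,
    fun n => ?_⟩
  have hconst : ∀ k, ∫ ω, M k ω ∂P = ∫ ω, M n ω ∂P := fun k => by
    have h0 : ∀ j, ∫ ω, M j ω ∂P = ∫ ω, M 0 ω ∂P := fun j => by
      have := hM.setIntegral_eq (Nat.zero_le j) (s := Set.univ) MeasurableSet.univ
      simpa using this.symm
    rw [h0 k, h0 n]
  -- The means of the `M k` are all equal, so the defect is at most the `L¹` distance of `M k` to
  -- the limit for every `k`.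
  rw [← sub_eq_zero, ← abs_nonpos_iff]
  refine ge_of_tendsto' habs fun k => ?_
  rw [← hconst k, ← integral_sub (hLmem.integrable one_le_two) ((hL k).integrable one_le_two)]
  refine abs_integral_le_integral_abs.trans (le_of_eq ?_)
  exact integral_congr_ae (ae_of_all _ fun ω => abs_sub_comm _ _)

end BoundedL2

/-! ### The urn martingale -/

section UrnMartingale

variable {Ω : Type*} [MeasurableSpace Ω] {P : Measure Ω} {a b c d S m : ℕ} {x₀ : ℕ × ℕ}
  {U : ℕ → Ω → ℕ × ℕ}

/-- The filtration generated by the urn process. -/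
def IsPolyaUrn.filtration (hU : IsPolyaUrn P a b c d x₀ U) : Filtration ℕ ‹MeasurableSpace Ω› where
  seq n := MeasurableSpace.comap (urnHistory U n) inferInstance
  mono' i j hij := by
    have h : urnHistory U i = (fun (H : Fin (j + 1) → ℕ × ℕ) (k : Fin (i + 1)) =>
        H ⟨k, by omega⟩) ∘ urnHistory U j := rfl
    dsimp only
    rw [h, ← MeasurableSpace.comap_comp]
    refine MeasurableSpace.comap_mono (Measurable.comap_le ?_)
    exact measurable_pi_iff.2 fun k => measurable_pi_apply _
  le' n := (hU.measurable_history n).comap_le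

/-- Since `u₂ (a, b) = m u₂ (1, 0)` and `u₂ (c, d) = m u₂ (0, 1)`, drawing a ball increases `u₂` by
`m` times the contribution of that ball. Summing over all balls gives the eigenvalue relation. -/
theorem urnForm_transition (hab : a + b = S) (hcd : c + d = S) (hm : a = c + m) (hS : 0 < S)
    (x : ℕ × ℕ) : urnGenerator a b c d (urnForm b c S) x =
      ((x.1 : ℝ) + x.2 + m) * urnForm b c S x := by
  have hS' : (S : ℝ) ≠ 0 := by positivity
  have e1 : (b : ℝ) = S - (c + m) := by rw [← hab, hm]; push_cast; ring
  have e2 : (d : ℝ) = S - c := by rw [← hcd]; push_cast; ring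
  have e3 : (a : ℝ) = c + m := by rw [hm]; push_cast; ring
  simp only [urnGenerator, urnForm, smul_eq_mul]
  push_cast
  rw [e1, e2, e3]
  field_simp
  ring

theorem urnForm_sq_transition (hab : a + b = S) (hcd : c + d = S) (hm : a = c + m) (hS : 0 < S)
    (x : ℕ × ℕ) : urnGenerator a b c d (fun y => urnForm b c S y ^ 2) x =
      ((x.1 : ℝ) + x.2 + 2 * m) * urnForm b c S x ^ 2 +
        (m / S : ℝ) ^ 2 * (b ^ 2 * x.1 + c ^ 2 * x.2) := by
  have hS' : (S : ℝ) ≠ 0 := by positivity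
  have e1 : (b : ℝ) = S - (c + m) := by rw [← hab, hm]; push_cast; ring
  have e2 : (d : ℝ) = S - c := by rw [← hcd]; push_cast; ring
  have e3 : (a : ℝ) = c + m := by rw [hm]; push_cast; ring
  simp only [urnGenerator, urnForm, smul_eq_mul]
  push_cast
  rw [e1, e2, e3]
  field_simp
  ring

theorem IsPolyaUrn.martingale [IsProbabilityMeasure P] (hab : a + b = S) (hcd : c + d = S)
    (hm : a = c + m) (hS : 0 < S) (hx : x₀.1 + x₀.2 = 1) (hU : IsPolyaUrn P a b c d x₀ U) :
    Martingale (fun n ω => urnForm b c S (U n ω) / urnGrowth S m n) hU.filtration P := by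
  have hint : ∀ n, Integrable (fun ω => urnForm b c S (U n ω) / urnGrowth S m n) P := fun n =>
    (hU.integrable_comp hab hcd n (urnForm b c S)).div_const _
  refine martingale_of_setIntegral_eq_succ ?_ hint ?_
  · intro n
    have h : (fun ω => urnForm b c S (U n ω) / urnGrowth S m n) =
        (fun H : Fin (n + 1) → ℕ × ℕ => urnForm b c S (H (Fin.last n)) / urnGrowth S m n) ∘
          urnHistory U n := rfl
    dsimp only
    rw [h]
    refine StronglyMeasurable.comp_measurable ?_ (comap_measurable _)
    exact ((Measurable.of_discrete (f := fun x => urnForm b c S x / urnGrowth S m n)).comp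
      (measurable_pi_apply _)).stronglyMeasurable
  · rintro n _ ⟨B, -, rfl⟩
    rw [hU.setIntegral_history hab hcd n B (fun x => urnForm b c S x / urnGrowth S m (n + 1))]
    have hms : MeasurableSet (urnHistory U n ⁻¹' B) :=
      hU.measurable_history n MeasurableSet.of_discrete
    refine setIntegral_congr_ae hms ?_
    filter_upwards [hU.ae_total hab hcd n] with ω hω _
    have ht : ((U n ω).1 : ℝ) + (U n ω).2 = 1 + n * S := by rw [← hx.symm] at hω; exact_mod_cast hω
    have hg := urnGrowth_pos S m n
    have hpos : (0 : ℝ) < 1 + n * S := by positivity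
    have e := urnForm_transition hab hcd hm hS (U n ω)
    simp only [urnGenerator, smul_eq_mul] at e
    simp only [urnTransition, urnGenerator, smul_eq_mul]
    rw [← mul_div_assoc, ← mul_div_assoc, ← add_div, e, ht, urnGrowth_succ]
    field_simp

/-- With total `T` the exact factor is `1 + 2m / T`. It is enlarged to `(1 + m / T) ^ 2`, the square
of the growth ratio, so that the recursion telescopes after normalization and leaves only a bounded
noise term. -/
theorem IsPolyaUrn.integral_sq_succ_le [IsProbabilityMeasure P] (hab : a + b = S) (hcd : c + d = S)
    (hm : a = c + m) (hS : 0 < S) (hx : x₀.1 + x₀.2 = 1) (hU : IsPolyaUrn P a b c d x₀ U) (n : ℕ) :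
    ∫ ω, urnForm b c S (U (n + 1) ω) ^ 2 ∂P ≤
      (1 + m / (1 + n * S)) ^ 2 * ∫ ω, urnForm b c S (U n ω) ^ 2 ∂P +
        (m / S : ℝ) ^ 2 * (b ^ 2 + c ^ 2) := by
  have hsq := hU.integrable_comp hab hcd n (fun x => urnForm b c S x ^ 2)
  rw [hU.integral_succ hab hcd n (fun x => urnForm b c S x ^ 2), ← integral_const_mul]
  have hc : ∫ _ω, (m / S : ℝ) ^ 2 * (b ^ 2 + c ^ 2) ∂P = (m / S : ℝ) ^ 2 * (b ^ 2 + c ^ 2) := by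
    simp
  rw [← hc, ← integral_add (hsq.const_mul _) (integrable_const _)]
  refine integral_mono_ae (hU.integrable_comp hab hcd n _)
    ((hsq.const_mul _).add (integrable_const _)) ?_
  filter_upwards [hU.ae_total hab hcd n] with ω hω
  have ht : ((U n ω).1 : ℝ) + (U n ω).2 = 1 + n * S := by rw [← hx.symm] at hω; exact_mod_cast hω
  have hpos : (0 : ℝ) < 1 + n * S := by positivity
  rw [urnTransition, urnForm_sq_transition hab hcd hm hS, ht, smul_eq_mul,
    inv_mul_le_iff₀ hpos]
  set u := urnForm b c S (U n ω) ^ 2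
  have hu : 0 ≤ u := sq_nonneg _
  set T : ℝ := 1 + n * S
  have h1 : ((U n ω).1 : ℝ) ≤ T := by rw [← ht]; simp
  have h2 : ((U n ω).2 : ℝ) ≤ T := by rw [← ht]; simp
  have e : T * ((1 + m / T) ^ 2 * u + (m / S : ℝ) ^ 2 * (b ^ 2 + c ^ 2)) =
      (T + 2 * m) * u + m ^ 2 / T * u + (m / S : ℝ) ^ 2 * (b ^ 2 * T + c ^ 2 * T) := by
    field_simp; ring
  rw [e]
  have h3 : (m / S : ℝ) ^ 2 * (b ^ 2 * (U n ω).1 + c ^ 2 * (U n ω).2) ≤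
      (m / S : ℝ) ^ 2 * (b ^ 2 * T + c ^ 2 * T) := by gcongr
  have h4 : 0 ≤ (m : ℝ) ^ 2 / T * u := by positivity
  linarith

theorem IsPolyaUrn.exists_integral_sq_le [IsProbabilityMeasure P] (hab : a + b = S)
    (hcd : c + d = S) (hm : a = c + m) (hS : 0 < S) (hlarge : S < 2 * m) (hx : x₀.1 + x₀.2 = 1)
    (hU : IsPolyaUrn P a b c d x₀ U) :
    ∃ K : ℝ, ∀ n, ∫ ω, (urnForm b c S (U n ω) / urnGrowth S m n) ^ 2 ∂P ≤ K := by
  have hs := (summable_nat_add_iff 1).2 (summable_inv_urnGrowth_sq hS hlarge)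
  set κ : ℝ := (m / S : ℝ) ^ 2 * (b ^ 2 + c ^ 2) with hκ
  have hκ0 : 0 ≤ κ := by positivity
  set v : ℕ → ℝ := fun n => ∫ ω, (urnForm b c S (U n ω) / urnGrowth S m n) ^ 2 ∂P with hv
  have hstep : ∀ n, v (n + 1) ≤ v n + κ * (1 / urnGrowth S m (n + 1) ^ 2) := by
    intro n
    have h := hU.integral_sq_succ_le hab hcd hm hS hx n
    have hg := urnGrowth_pos S m n
    have hg' := urnGrowth_pos S m (n + 1)
    simp only [hv, div_pow, integral_div]
    have e : (∫ ω, urnForm b c S (U n ω) ^ 2 ∂P) / urnGrowth S m n ^ 2 =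
        (1 + m / (1 + n * S)) ^ 2 * (∫ ω, urnForm b c S (U n ω) ^ 2 ∂P) /
          urnGrowth S m (n + 1) ^ 2 := by
      have : (0 : ℝ) < 1 + m / (1 + n * S) := by positivity
      rw [urnGrowth_succ]; field_simp
    rw [e, mul_one_div, ← add_div]
    gcongr
  have hbound : ∀ n, v n ≤ v 0 + κ * ∑ j ∈ Finset.range n, 1 / urnGrowth S m (j + 1) ^ 2 := by
    intro n
    induction n with
    | zero => simp
    | succ n ih =>
      rw [Finset.sum_range_succ, mul_add, ← add_assoc]
      exact (hstep n).trans (by gcongr)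
  refine ⟨v 0 + κ * ∑' j, 1 / urnGrowth S m (j + 1) ^ 2, fun n => (hbound n).trans ?_⟩
  gcongr
  exact hs.sum_le_tsum _ fun j _ => by positivity

theorem IsPolyaUrn.memLp_form [IsFiniteMeasure P] (hab : a + b = S) (hcd : c + d = S)
    (hU : IsPolyaUrn P a b c d x₀ U) (n : ℕ) (r : ℝ) :
    MemLp (fun ω => urnForm b c S (U n ω) / r) 2 P := by
  rw [memLp_two_iff_integrable_sq
    (hU.integrable_comp hab hcd n (fun x => urnForm b c S x / r)).aestronglyMeasurable]
  exact hU.integrable_comp hab hcd n (fun x => (urnForm b c S x / r) ^ 2)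

/-- Almost sure and `L¹` convergence of the normalized urn process. -/
theorem IsPolyaUrn.limit [IsProbabilityMeasure P] (hab : a + b = S)
    (hcd : c + d = S) (hm : a = c + m) (hS : 0 < S) (hlarge : S < 2 * m) (hx : x₀.1 + x₀.2 = 1)
    (hU : IsPolyaUrn P a b c d x₀ U) :
    (∀ᵐ ω ∂P, Tendsto (urnNormalized b c S ((m : ℝ) / S) (fun n => U n ω)) atTop
        (𝓝 (urnLimit b c S ((m : ℝ) / S) U ω))) ∧
      MemLp (urnLimit b c S ((m : ℝ) / S) U) 2 P ∧
      ∫ ω, urnLimit b c S ((m : ℝ) / S) U ω ∂P =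
        Real.Gamma (1 / (S : ℝ)) / Real.Gamma (((m : ℝ) + 1) / S) * urnForm b c S x₀ ∧
      Tendsto (fun n : ℕ => ∫ ω, |urnNormalized b c S ((m : ℝ) / S) (fun n => U n ω) n -
        urnLimit b c S ((m : ℝ) / S) U ω| ∂P) atTop (𝓝 0) := by
  set σ : ℝ := (m : ℝ) / S with hσ
  set ℓ := Real.Gamma (1 / (S : ℝ)) / Real.Gamma (((m : ℝ) + 1) / S) with hℓ
  obtain ⟨K, hK⟩ := hU.exists_integral_sq_le hab hcd hm hS hlarge hx
  obtain ⟨L, hL1, hL2, hL3, hL4⟩ := Martingale.exists_limit_of_integral_sq_le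
    (hU.martingale hab hcd hm hS hx) (fun n => hU.memLp_form hab hcd n _) hK
  set ρ : ℕ → ℝ := fun n => urnGrowth S m n / (n : ℝ) ^ σ with hρ
  have hρlim : Tendsto ρ atTop (𝓝 ℓ) := tendsto_urnGrowth_div_rpow hS m
  have hnorm : ∀ ω n, urnNormalized b c S σ (fun n => U n ω) n =
      ρ n * (urnForm b c S (U n ω) / urnGrowth S m n) := by
    intro ω n
    have := (urnGrowth_pos S m n).ne'
    simp only [urnNormalized, hρ]
    field_simp
  have hae : ∀ᵐ ω ∂P, Tendsto (urnNormalized b c S σ (fun n => U n ω)) atTop (𝓝 (ℓ * L ω)) := by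
    filter_upwards [hL1] with ω hω
    exact (hρlim.mul hω).congr fun n => (hnorm ω n).symm
  have hW : ∀ᵐ ω ∂P, urnLimit b c S σ U ω = ℓ * L ω := by
    filter_upwards [hae] with ω hω
    exact hω.limUnder_eq
  refine ⟨?_, ?_, ?_, ?_⟩
  · filter_upwards [hae, hW] with ω h1 h2
    rwa [h2]
  · exact (memLp_congr_ae hW).2 (hL2.const_mul ℓ)
  · rw [integral_congr_ae hW, integral_const_mul, hL4 0]
    congr 1
    rw [integral_congr_ae (g := fun _ => urnForm b c S x₀)]
    · simp
    · filter_upwards [hU.initial] with ω hω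
      simp [hω, urnGrowth, rising]
  · have hLi := hL2.integrable one_le_two
    have hMi : ∀ n, Integrable (fun ω => urnForm b c S (U n ω) / urnGrowth S m n) P :=
      fun n => (hU.memLp_form hab hcd n _).integrable one_le_two
    -- With `M` the martingale, the error splits as `ρ M - ℓ L = ρ (M - L) + (ρ - ℓ) L`.
    have hlim : Tendsto (fun n => |ρ n| * (∫ ω, |urnForm b c S (U n ω) / urnGrowth S m n - L ω| ∂P)
        + |ρ n - ℓ| * ∫ ω, |L ω| ∂P) atTop (𝓝 0) := by
      have h1 := hρlim.abs.mul hL3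
      have h2 := ((hρlim.sub_const ℓ).abs).mul_const (∫ ω, |L ω| ∂P)
      simpa using h1.add h2
    refine squeeze_zero (fun n => integral_nonneg fun ω => abs_nonneg _) (fun n => ?_) hlim
    have hdi : Integrable (fun ω => |urnForm b c S (U n ω) / urnGrowth S m n - L ω|) P :=
      ((hMi n).sub hLi).abs
    rw [← integral_const_mul, ← integral_const_mul,
      ← integral_add (hdi.const_mul _) (hLi.abs.const_mul _)]
    refine integral_mono_of_nonneg (ae_of_all _ fun ω => abs_nonneg _)
      ((hdi.const_mul _).add (hLi.abs.const_mul _)) ?_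
    filter_upwards [hW] with ω hω
    rw [hnorm, hω, ← abs_mul, ← abs_mul]
    refine le_trans (le_of_eq ?_) (abs_add_le _ _)
    congr 1
    ring

end UrnMartingale

/-! ### Generating functions and the branching property -/

/-- The exponential generating function of the iterates of the generator. -/
def urnSeries (a b c d : ℕ) (g : ℕ × ℕ → ℂ) (x : ℕ × ℕ) : PowerSeries ℂ :=
  PowerSeries.mk fun n => (urnGenerator a b c d)^[n] g x / n.factorial

/-- The series is formally `exp (zG) g`, with `G` the generator; differentiation in `z` applies `G`
once more, on the outside. -/
theorem derivative_urnSeries (a b c d : ℕ) (g : ℕ × ℕ → ℂ) (x : ℕ × ℕ) :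
    PowerSeries.derivative ℂ (urnSeries a b c d g x) =
      PowerSeries.C (x.1 : ℂ) * urnSeries a b c d g (x.1 + a, x.2 + b) +
        PowerSeries.C (x.2 : ℂ) * urnSeries a b c d g (x.1 + c, x.2 + d) := by
  ext n
  rw [PowerSeries.coeff_derivative]
  have h : (n.factorial : ℂ) ≠ 0 := by exact_mod_cast n.factorial_ne_zero
  have h' : (n : ℂ) + 1 ≠ 0 := by exact_mod_cast n.succ_ne_zero
  simp only [urnSeries, PowerSeries.coeff_mk, map_add, PowerSeries.coeff_C_mul,
    Function.iterate_succ_apply', Nat.factorial_succ]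
  conv_lhs => rw [urnGenerator]
  simp only [Complex.real_smul]
  push_cast
  field_simp

/-- The branching property in algebraic form. A draw from the union of two urns is a draw from one
of them, so by the Leibniz rule both sides satisfy the same linear differential system. Coefficients
are then matched by induction on the order, for all compositions simultaneously. -/
theorem urnSeries_add (a b c d : ℕ) {g : ℕ × ℕ → ℂ} (hg : ∀ x y, g (x + y) = g x * g y)
    (x y : ℕ × ℕ) :
    urnSeries a b c d g (x + y) = urnSeries a b c d g x * urnSeries a b c d g y := by
  ext n
  induction n generalizing x y with
  | zero => simp [urnSeries, hg]
  | succ n ih =>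
    have h' : (n : ℂ) + 1 ≠ 0 := by exact_mod_cast n.succ_ne_zero
    refine mul_right_cancel₀ h' ?_
    rw [← PowerSeries.coeff_derivative, ← PowerSeries.coeff_derivative, Derivation.leibniz,
      derivative_urnSeries, derivative_urnSeries, derivative_urnSeries]
    have e1 := ih (x.1 + a, x.2 + b) y
    have e2 := ih (x.1 + c, x.2 + d) y
    have e3 := ih x (y.1 + a, y.2 + b)
    have e4 := ih x (y.1 + c, y.2 + d)
    have f1 : ∀ u v : ℕ, ((x + y).1 + u, (x + y).2 + v) = (x.1 + u, x.2 + v) + y := fun u v => by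
      ext <;> simp <;> ring
    have f2 : ∀ u v : ℕ, (x.1 + u, x.2 + v) + y = x + (y.1 + u, y.2 + v) := fun u v => by
      ext <;> simp <;> ring
    rw [f2] at e1 e2
    simp only [f1, f2, smul_eq_mul, mul_add, map_add, ← mul_assoc, mul_comm _ (PowerSeries.C _)]
    simp only [mul_assoc, PowerSeries.coeff_C_mul, Prod.fst_add, Prod.snd_add]
    rw [mul_comm (urnSeries a b c d g y), mul_comm (urnSeries a b c d g y), ← e1, ← e2, e3, e4,
      ← e3, ← e4]
    push_cast
    ring

theorem urnGenerator_iterate_zero (a b c d : ℕ) (g : ℕ × ℕ → ℂ) (n : ℕ) :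
    (urnGenerator a b c d)^[n + 1] g 0 = 0 := by
  rw [Function.iterate_succ_apply', urnGenerator]
  simp

theorem urnSeries_sum (a b c d : ℕ) {g : ℕ × ℕ → ℂ} (hg : ∀ x y, g (x + y) = g x * g y)
    (hg0 : g 0 = 1) {ι : Type*} (s : Finset ι) (x : ι → ℕ × ℕ) :
    urnSeries a b c d g (∑ i ∈ s, x i) = ∏ i ∈ s, urnSeries a b c d g (x i) := by
  classical
  induction s using Finset.induction_on with
  | empty =>
    ext n
    rcases n with _ | n
    · simp [urnSeries, hg0]
    · simp [urnSeries, urnGenerator_iterate_zero, PowerSeries.coeff_one,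
        -Function.iterate_succ]
  | insert i s hi ih => rw [Finset.sum_insert hi, Finset.prod_insert hi, urnSeries_add _ _ _ _ hg, ih]

/-! ### Multinomial weights -/

/-- The probability that a multinomial variable with parameters `n` and `V` takes the value `l`. -/
def multinomialWeight {N : ℕ} (n : ℕ) (V : Fin N → ℝ) (l : Fin N →₀ ℕ) : ℝ :=
  n.factorial * ∏ k, (V k ^ l k / (l k).factorial)

theorem multinomialWeight_nonneg {N : ℕ} (n : ℕ) {V : Fin N → ℝ} (hV : ∀ k, 0 ≤ V k)
    (l : Fin N →₀ ℕ) : 0 ≤ multinomialWeight n V l :=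
  mul_nonneg (by positivity) (Finset.prod_nonneg fun k _ => by have := hV k; positivity)

theorem coeff_rescale_exp (v : ℝ) (n : ℕ) :
    PowerSeries.coeff n (PowerSeries.rescale v (PowerSeries.exp ℝ)) = v ^ n / n.factorial := by
  simp [PowerSeries.coeff_rescale, PowerSeries.coeff_exp, div_eq_mul_inv]

theorem prod_rescale_exp {ι : Type*} (s : Finset ι) (v : ι → ℝ) :
    ∏ i ∈ s, PowerSeries.rescale (v i) (PowerSeries.exp ℝ) =
      PowerSeries.rescale (∑ i ∈ s, v i) (PowerSeries.exp ℝ) := by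
  classical
  induction s using Finset.induction_on with
  | empty => ext n; rcases n with _ | n <;> simp [PowerSeries.coeff_one]
  | insert i s hi ih =>
    rw [Finset.prod_insert hi, Finset.sum_insert hi, ih, PowerSeries.exp_mul_exp_eq_exp_add]

/-- The one-dimensional marginals of a multinomial distribution are binomial. -/
theorem sum_multinomialWeight_mul {N : ℕ} (n : ℕ) {V : Fin N → ℝ} (hV : ∑ k, V k = 1) (j : Fin N)
    (h : ℕ → ℝ) :
    ∑ l ∈ Finset.finsuppAntidiag Finset.univ n, multinomialWeight n V l * h (l j) =
      ∑ i ∈ Finset.range (n + 1), (n.choose i * V j ^ i * (1 - V j) ^ (n - i)) * h i := by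
  -- The `j`-th exponential series carries the extra weights `h`. The remaining ones multiply to
  -- `exp ((1 - V j) z)`, so the `n`-th coefficient of the product is a binomial sum.
  set f : Fin N → PowerSeries ℝ := fun k => if k = j then
    PowerSeries.mk fun i => V j ^ i / i.factorial * h i
    else PowerSeries.rescale (V k) (PowerSeries.exp ℝ) with hf
  have h1 := PowerSeries.coeff_prod f n Finset.univ
  have hprod : ∏ k, f k = (PowerSeries.mk fun i => V j ^ i / i.factorial * h i) *
      PowerSeries.rescale (1 - V j) (PowerSeries.exp ℝ) := by
    rw [← Finset.mul_prod_erase _ _ (Finset.mem_univ j)]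
    congr 1
    · simp [hf]
    · rw [← hV, ← Finset.add_sum_erase _ _ (Finset.mem_univ j), add_sub_cancel_left,
        ← prod_rescale_exp]
      exact Finset.prod_congr rfl fun k hk => if_neg (Finset.ne_of_mem_erase hk)
  have hterm : ∀ l : Fin N →₀ ℕ, multinomialWeight n V l * h (l j) =
      n.factorial * ∏ k, PowerSeries.coeff (l k) (f k) := by
    intro l
    rw [multinomialWeight, mul_assoc, ← Finset.mul_prod_erase _ _ (Finset.mem_univ j),
      ← Finset.mul_prod_erase _ (fun k => PowerSeries.coeff (l k) (f k)) (Finset.mem_univ j)]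
    have e : ∏ k ∈ Finset.univ.erase j, PowerSeries.coeff (l k) (f k) =
        ∏ k ∈ Finset.univ.erase j, V k ^ l k / (l k).factorial :=
      Finset.prod_congr rfl fun k hk => by
        rw [hf]; simp only [if_neg (Finset.ne_of_mem_erase hk)]; rw [coeff_rescale_exp]
    rw [e]
    simp only [hf, if_true, PowerSeries.coeff_mk]
    ring
  simp_rw [hterm]
  rw [← Finset.mul_sum, ← h1, hprod, PowerSeries.coeff_mul,
    Finset.Nat.sum_antidiagonal_eq_sum_range_succ_mk, Finset.mul_sum]
  refine Finset.sum_congr rfl fun i hi => ?_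
  have hi' : i ≤ n := Nat.lt_succ_iff.1 (Finset.mem_range.1 hi)
  simp only [PowerSeries.coeff_mk, coeff_rescale_exp]
  rw [Nat.cast_choose ℝ hi']
  have h2 : (i.factorial : ℝ) ≠ 0 := by exact_mod_cast i.factorial_ne_zero
  have h3 : ((n - i).factorial : ℝ) ≠ 0 := by exact_mod_cast (n - i).factorial_ne_zero
  field_simp

theorem sum_multinomialWeight {N : ℕ} (n : ℕ) {V : Fin N → ℝ} (hV : ∑ k, V k = 1) (j : Fin N) :
    ∑ l ∈ Finset.finsuppAntidiag Finset.univ n, multinomialWeight n V l = 1 := by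
  have h := sum_multinomialWeight_mul n hV j fun _ => 1
  simp only [mul_one] at h
  rw [h]
  have := (add_pow (V j) (1 - V j) n).symm
  rw [add_sub_cancel, one_pow] at this
  exact (Finset.sum_congr rfl fun i _ => by ring).trans this

/-- The law of large numbers for a marginal of a multinomial distribution. -/
theorem tendsto_sum_multinomialWeight {N : ℕ} {V : Fin N → ℝ}
    (hV : (∀ k, 0 ≤ V k) ∧ ∑ k, V k = 1) {σ : ℝ} (hσ : 0 ≤ σ) (j : Fin N) :
    Tendsto (fun n : ℕ => ∑ l ∈ Finset.finsuppAntidiag Finset.univ n,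
      multinomialWeight n V l * |((l j : ℝ) / n) ^ σ - V j ^ σ|) atTop (𝓝 0) := by
  have h1 : V j ≤ 1 := hV.2 ▸ Finset.single_le_sum (fun i _ => hV.1 i) (Finset.mem_univ j)
  let v : unitInterval := ⟨V j, hV.1 j, h1⟩
  -- The binomial sum is the Bernstein polynomial of this function evaluated at `V j`, where the
  -- function vanishes.
  let f : C(unitInterval, ℝ) := ⟨fun x => |(x : ℝ) ^ σ - V j ^ σ|,
    ((continuous_subtype_val.rpow_const fun x => Or.inr hσ).sub continuous_const).abs⟩
  have hlim := ((continuous_eval_const (F := C(unitInterval, ℝ)) v).tendsto f).comp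
    (bernsteinApproximation_uniform f)
  have hfv : f v = 0 := by simp [f, v]
  rw [hfv] at hlim
  refine hlim.congr fun n => ?_
  rw [Function.comp_apply, bernsteinApproximation.apply,
    sum_multinomialWeight_mul n hV.2 j (fun i => |((i : ℝ) / n) ^ σ - V j ^ σ|),
    ← Fin.sum_univ_eq_sum_range
      (fun i => (n.choose i * V j ^ i * (1 - V j) ^ (n - i)) * |((i : ℝ) / n) ^ σ - V j ^ σ|)]
  refine Finset.sum_congr rfl fun i _ => ?_
  rw [bernstein_apply, smul_eq_mul]
  rfl

theorem norm_prod_sub_prod_le_sum {ι : Type*} (s : Finset ι) {f g : ι → ℂ} (hf : ∀ i, ‖f i‖ ≤ 1)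
    (hg : ∀ i, ‖g i‖ ≤ 1) : ‖∏ i ∈ s, f i - ∏ i ∈ s, g i‖ ≤ ∑ i ∈ s, ‖f i - g i‖ := by
  classical
  induction s using Finset.induction_on with
  | empty => simp
  | insert i s hi ih =>
    rw [Finset.prod_insert hi, Finset.prod_insert hi, Finset.sum_insert hi]
    have e : f i * ∏ x ∈ s, f x - g i * ∏ x ∈ s, g x =
        (f i - g i) * ∏ x ∈ s, f x + g i * (∏ x ∈ s, f x - ∏ x ∈ s, g x) := by ring
    rw [e]
    refine (norm_add_le _ _).trans (add_le_add ?_ ?_)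
    · rw [norm_mul]
      refine mul_le_of_le_one_right (norm_nonneg _) ?_
      rw [norm_prod]
      exact Finset.prod_le_one (fun _ _ => norm_nonneg _) fun x _ => hf x
    · rw [norm_mul]
      exact (mul_le_of_le_one_left (norm_nonneg _) (hg i)).trans ih

/-- Convergence of multinomial mixtures of products of characteristic functions. -/
theorem tendsto_multinomial_prod {N : ℕ} {V : Fin N → ℝ} (hV : (∀ k, 0 ≤ V k) ∧ ∑ k, V k = 1)
    {σ : ℝ} (hσ : 0 < σ) (t : ℝ) {φ : Fin N → ℕ → ℝ → ℂ} {ψ : Fin N → ℝ → ℂ}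
    (hφ : ∀ k i s, ‖φ k i s‖ ≤ 1) (hψ : ∀ k s, ‖ψ k s‖ ≤ 1) {η : Fin N → ℕ → ℝ} {C : Fin N → ℝ}
    (hη0 : ∀ k i, 0 ≤ η k i)
    (hη : ∀ k, ∀ ε > 0, ∃ M, ∀ i : ℕ, η k i ≤ ε * (i : ℝ) ^ σ + M)
    (hφψ : ∀ k i (n : ℕ), 0 < n → ∀ v, 0 ≤ v → ‖φ k i (t / (n : ℝ) ^ σ) - ψ k (t * v ^ σ)‖ ≤
      |t| * (η k i / (n : ℝ) ^ σ + |((i : ℝ) / n) ^ σ - v ^ σ| * C k)) :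
    Tendsto (fun n : ℕ => ∑ l ∈ Finset.finsuppAntidiag Finset.univ n,
        (multinomialWeight n V l : ℂ) * ∏ k, φ k (l k) (t / (n : ℝ) ^ σ)) atTop
      (𝓝 (∏ k, ψ k (t * V k ^ σ))) := by
  have hne : Nonempty (Fin N) := by
    by_contra h
    rw [not_nonempty_iff] at h
    simpa using hV.2
  set w : ℕ → (Fin N →₀ ℕ) → ℝ := fun n l => multinomialWeight n V l with hw
  have hw0 : ∀ n l, 0 ≤ w n l := fun n l => multinomialWeight_nonneg n hV.1 l
  have hw1 : ∀ n, ∑ l ∈ Finset.finsuppAntidiag Finset.univ n, w n l = 1 := fun n =>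
    sum_multinomialWeight n hV.2 hne.some
  have hpow : Tendsto (fun n : ℕ => (n : ℝ) ^ σ) atTop atTop :=
    (tendsto_rpow_atTop hσ).comp tendsto_natCast_atTop_atTop
  have hA : ∀ k, Tendsto (fun n : ℕ => ∑ l ∈ Finset.finsuppAntidiag Finset.univ n,
      w n l * (η k (l k) / (n : ℝ) ^ σ)) atTop (𝓝 0) := by
    intro k
    refine tendsto_order.2 ⟨fun e he => Eventually.of_forall fun n => he.trans_le ?_, fun ε hε => ?_⟩
    · exact Finset.sum_nonneg fun l _ => mul_nonneg (hw0 n l) (div_nonneg (hη0 _ _) (by positivity))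
    -- A share `l k` may stay small as `n` grows; the constant `M` absorbs those indices, while `l k
    -- ≤ n` controls the rest.
    obtain ⟨M, hM⟩ := hη k (ε / 2) (by positivity)
    filter_upwards [(hpow.const_div_atTop M).eventually_lt_const (half_pos hε),
      eventually_gt_atTop 0] with n hn hn0
    have hn' : (0 : ℝ) < (n : ℝ) ^ σ := Real.rpow_pos_of_pos (by exact_mod_cast hn0) _
    calc ∑ l ∈ Finset.finsuppAntidiag Finset.univ n, w n l * (η k (l k) / (n : ℝ) ^ σ)
        ≤ ∑ l ∈ Finset.finsuppAntidiag Finset.univ n, w n l * (ε / 2 + M / (n : ℝ) ^ σ) := by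
          refine Finset.sum_le_sum fun l hl => mul_le_mul_of_nonneg_left ?_ (hw0 n l)
          have hlk : l k ≤ n := (Finset.mem_finsuppAntidiag.1 hl).1 ▸
            Finset.single_le_sum (f := fun i => l i) (fun _ _ => Nat.zero_le _) (Finset.mem_univ k)
          have hlk' : ((l k : ℕ) : ℝ) ^ σ ≤ (n : ℝ) ^ σ := by gcongr
          rw [show ε / 2 + M / (n : ℝ) ^ σ = (ε / 2 * (n : ℝ) ^ σ + M) / (n : ℝ) ^ σ by field_simp]
          refine div_le_div_of_nonneg_right ((hM (l k)).trans ?_) hn'.le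
          gcongr
      _ = ε / 2 + M / (n : ℝ) ^ σ := by rw [← Finset.sum_mul, hw1, one_mul]
      _ < ε := by linarith
  have hlim : Tendsto (fun n : ℕ => |t| * ∑ k, ((∑ l ∈ Finset.finsuppAntidiag Finset.univ n,
      w n l * (η k (l k) / (n : ℝ) ^ σ)) + (∑ l ∈ Finset.finsuppAntidiag Finset.univ n,
        w n l * |((l k : ℝ) / n) ^ σ - V k ^ σ|) * C k)) atTop (𝓝 0) := by
    have := (tendsto_finsetSum (Finset.univ : Finset (Fin N)) fun k _ =>
      (hA k).add ((tendsto_sum_multinomialWeight hV hσ.le k).mul_const (C k))).const_mul |t|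
    simpa using this
  refine tendsto_iff_norm_sub_tendsto_zero.2 (squeeze_zero' (Eventually.of_forall fun n =>
    norm_nonneg _) ?_ hlim)
  filter_upwards [eventually_gt_atTop 0] with n hn
  have e : ∑ l ∈ Finset.finsuppAntidiag Finset.univ n,
        (multinomialWeight n V l : ℂ) * ∏ k, φ k (l k) (t / (n : ℝ) ^ σ) - ∏ k, ψ k (t * V k ^ σ) =
      ∑ l ∈ Finset.finsuppAntidiag Finset.univ n, (w n l : ℂ) *
        (∏ k, φ k (l k) (t / (n : ℝ) ^ σ) - ∏ k, ψ k (t * V k ^ σ)) := by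
    simp_rw [mul_sub, Finset.sum_sub_distrib]
    rw [← Finset.sum_mul, ← Complex.ofReal_sum, hw1, Complex.ofReal_one, one_mul]
  rw [e]
  calc _ ≤ ∑ l ∈ Finset.finsuppAntidiag Finset.univ n, w n l *
        ∑ k, |t| * (η k (l k) / (n : ℝ) ^ σ + |((l k : ℝ) / n) ^ σ - V k ^ σ| * C k) := by
        refine (norm_sum_le _ _).trans (Finset.sum_le_sum fun l _ => ?_)
        rw [norm_mul, Complex.norm_real, Real.norm_of_nonneg (hw0 n l)]
        refine mul_le_mul_of_nonneg_left ?_ (hw0 n l)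
        refine (norm_prod_sub_prod_le_sum _ (fun k => hφ _ _ _) fun k => hψ _ _).trans ?_
        exact Finset.sum_le_sum fun k _ => hφψ k (l k) n hn (V k) (hV.1 k)
    _ = _ := by
        simp_rw [Finset.sum_mul, ← Finset.sum_add_distrib]
        simp_rw [Finset.mul_sum]
        rw [Finset.sum_comm]
        refine Finset.sum_congr rfl fun k _ => Finset.sum_congr rfl fun l _ => ?_
        ring

/-! ### The limit laws solve the distributional system -/

section Limit

variable {Ω : Type*} [MeasurableSpace Ω] {P : Measure Ω} {a b c d S m : ℕ} {x₀ : ℕ × ℕ}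
  {U : ℕ → Ω → ℕ × ℕ}

/-- The law of `u₂ (U n)`. -/
def urnFormLaw (b c S : ℕ) (P : Measure Ω) (U : ℕ → Ω → ℕ × ℕ) (n : ℕ) : Measure ℝ :=
  P.map fun ω => urnForm b c S (U n ω)

/-- The character `x ↦ exp (i s u₂ x)`. -/
def urnCharacter (b c S : ℕ) (s : ℝ) (x : ℕ × ℕ) : ℂ :=
  Complex.exp (s * urnForm b c S x * Complex.I)

theorem urnCharacter_add (b c S : ℕ) (s : ℝ) (x y : ℕ × ℕ) :
    urnCharacter b c S s (x + y) = urnCharacter b c S s x * urnCharacter b c S s y := by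
  have h : urnForm b c S (x + y) = urnForm b c S x + urnForm b c S y := by
    simp only [urnForm, Prod.fst_add, Prod.snd_add]; push_cast; ring
  rw [urnCharacter, urnCharacter, urnCharacter, ← Complex.exp_add, h]
  push_cast
  congr 1
  ring

theorem urnCharacter_zero (b c S : ℕ) (s : ℝ) : urnCharacter b c S s 0 = 1 := by
  simp [urnCharacter, urnForm]

theorem IsPolyaUrn.measurable_form (hU : IsPolyaUrn P a b c d x₀ U) (n : ℕ) :
    Measurable fun ω => urnForm b c S (U n ω) :=
  (Measurable.of_discrete (f := urnForm b c S)).comp (hU.measurable n)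

theorem IsPolyaUrn.isProbabilityMeasure_formLaw [IsProbabilityMeasure P]
    (hU : IsPolyaUrn P a b c d x₀ U) (n : ℕ) : IsProbabilityMeasure (urnFormLaw b c S P U n) :=
  Measure.isProbabilityMeasure_map (hU.measurable_form n).aemeasurable

theorem IsPolyaUrn.iterate_urnCharacter [IsProbabilityMeasure P] (hab : a + b = S)
    (hcd : c + d = S) (hx : x₀.1 + x₀.2 = 1) (hU : IsPolyaUrn P a b c d x₀ U) (n : ℕ) (s : ℝ) :
    (urnGenerator a b c d)^[n] (urnCharacter b c S s) x₀ =
      rising S 1 n * charFun (urnFormLaw b c S P U n) s := by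
  have h := hU.integral_eq_iterate hab hcd n (urnCharacter b c S s)
  have hx' : (x₀.1 : ℝ) + x₀.2 = 1 := by exact_mod_cast hx
  have hr : (rising S 1 n : ℂ) ≠ 0 := by exact_mod_cast (rising_pos S one_pos n).ne'
  rw [hx', Complex.real_smul, Complex.ofReal_inv, eq_inv_mul_iff_mul_eq₀ hr] at h
  rw [← h, charFun_apply_real, urnFormLaw, integral_map (hU.measurable_form n).aemeasurable
    (by fun_prop)]
  rfl

/-- The `L¹` distance between `u₂ (U n)` and `n ^ σ W`. -/
def urnError (b c S : ℕ) (σ : ℝ) (P : Measure Ω) (U : ℕ → Ω → ℕ × ℕ) (n : ℕ) : ℝ :=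
  ∫ ω, |urnForm b c S (U n ω) - (n : ℝ) ^ σ * urnLimit b c S σ U ω| ∂P

theorem urnError_nonneg (b c S : ℕ) (σ : ℝ) (P : Measure Ω) (U : ℕ → Ω → ℕ × ℕ) (n : ℕ) :
    0 ≤ urnError b c S σ P U n := integral_nonneg fun _ => abs_nonneg _

theorem IsPolyaUrn.tendsto_urnError_div [IsProbabilityMeasure P] (hab : a + b = S)
    (hcd : c + d = S) (hm : a = c + m) (hS : 0 < S) (hlarge : S < 2 * m) (hx : x₀.1 + x₀.2 = 1)
    (hU : IsPolyaUrn P a b c d x₀ U) :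
    Tendsto (fun n : ℕ => urnError b c S ((m : ℝ) / S) P U n / (n : ℝ) ^ ((m : ℝ) / S)) atTop
      (𝓝 0) := by
  obtain ⟨-, -, -, h⟩ := hU.limit hab hcd hm hS hlarge hx
  refine h.congr' ?_
  filter_upwards [eventually_gt_atTop 0] with n hn
  have hp : (0 : ℝ) < (n : ℝ) ^ ((m : ℝ) / S) := Real.rpow_pos_of_pos (by exact_mod_cast hn) _
  rw [urnError, ← integral_div]
  congr 1 with ω
  rw [← abs_of_pos hp, ← abs_div, abs_of_pos hp, sub_div, mul_div_cancel_left₀ _ hp.ne']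
  rfl

/-- Here `i` is the number of draws allotted to one subtree among `n`, and `v` the limiting share.
The bound inserts `(i / n) ^ σ W` between `u₂ (U i) / n ^ σ` and `v ^ σ W`. -/
theorem IsPolyaUrn.norm_charFun_sub_le [IsProbabilityMeasure P] (hab : a + b = S)
    (hcd : c + d = S) (hm : a = c + m) (hS : 0 < S) (hlarge : S < 2 * m) (hx : x₀.1 + x₀.2 = 1)
    (hU : IsPolyaUrn P a b c d x₀ U) (t : ℝ) (i n : ℕ) (hn : 0 < n) (v : ℝ) :
    ‖charFun (urnFormLaw b c S P U i) (t / (n : ℝ) ^ ((m : ℝ) / S)) -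
        charFun (P.map (urnLimit b c S ((m : ℝ) / S) U)) (t * v ^ ((m : ℝ) / S))‖ ≤
      |t| * (urnError b c S ((m : ℝ) / S) P U i / (n : ℝ) ^ ((m : ℝ) / S) +
        |((i : ℝ) / n) ^ ((m : ℝ) / S) - v ^ ((m : ℝ) / S)| *
          ∫ ω, |urnLimit b c S ((m : ℝ) / S) U ω| ∂P) := by
  obtain ⟨-, hL, -, -⟩ := hU.limit hab hcd hm hS hlarge hx
  set σ : ℝ := (m : ℝ) / S with hσ
  set W := urnLimit b c S σ U with hW
  have hp : (0 : ℝ) < (n : ℝ) ^ σ := Real.rpow_pos_of_pos (by exact_mod_cast hn) _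
  have hWi : Integrable W P := hL.integrable one_le_two
  have hFi : Integrable (fun ω => urnForm b c S (U i ω)) P := hU.integrable_comp hab hcd i _
  have hWm := hWi.aestronglyMeasurable.aemeasurable
  have e1 : charFun (urnFormLaw b c S P U i) (t / (n : ℝ) ^ σ) =
      charFun (P.map fun ω => ((n : ℝ) ^ σ)⁻¹ * urnForm b c S (U i ω)) t := by
    rw [charFun_map_mul_comp (hU.measurable_form i).aemeasurable, urnFormLaw, div_eq_inv_mul]
  have e2 : charFun (P.map W) (t * v ^ σ) = charFun (P.map fun ω => v ^ σ * W ω) t := by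
    rw [charFun_map_mul_comp hWm, mul_comm]
  rw [e1, e2]
  have hd : Integrable (fun ω => ((n : ℝ) ^ σ)⁻¹ * urnForm b c S (U i ω) - v ^ σ * W ω) P :=
    (hFi.const_mul _).sub (hWi.const_mul _)
  have hE : Integrable (fun ω => |urnForm b c S (U i ω) - (i : ℝ) ^ σ * W ω|) P :=
    (hFi.sub (hWi.const_mul _)).abs
  refine (norm_charFun_map_sub_le ((hU.measurable_form i).const_mul _).aemeasurable
    (hWm.const_mul _) hd t).trans ?_
  refine mul_le_mul_of_nonneg_left ?_ (abs_nonneg t)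
  rw [urnError, ← integral_div, ← integral_const_mul,
    ← integral_add (hE.div_const _) (hWi.abs.const_mul _)]
  refine integral_mono_of_nonneg (ae_of_all _ fun ω => abs_nonneg _)
    ((hE.div_const _).add (hWi.abs.const_mul _)) (ae_of_all _ fun ω => ?_)
  dsimp only
  rw [← abs_mul, ← abs_of_pos hp, ← abs_div, abs_of_pos hp, Real.div_rpow (by positivity)
    (by positivity)]
  refine le_trans (le_of_eq ?_) (abs_add_le _ _)
  congr 1
  field_simp
  ring

end Limit

theorem exists_le_rpow_add_of_tendsto_div {η : ℕ → ℝ} (hη0 : ∀ n, 0 ≤ η n) {σ : ℝ}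
    (h : Tendsto (fun n : ℕ => η n / (n : ℝ) ^ σ) atTop (𝓝 0)) {ε : ℝ} (hε : 0 < ε) :
    ∃ M, ∀ i : ℕ, η i ≤ ε * (i : ℝ) ^ σ + M := by
  obtain ⟨N, hN⟩ := eventually_atTop.1 ((h.eventually_lt_const hε).and (eventually_gt_atTop 0))
  refine ⟨∑ j ∈ Finset.range N, η j, fun i => ?_⟩
  have hs : 0 ≤ ∑ j ∈ Finset.range N, η j := Finset.sum_nonneg fun j _ => hη0 j
  rcases lt_or_ge i N with hi | hi
  · have := Finset.single_le_sum (fun j _ => hη0 j) (Finset.mem_range.2 hi)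
    have : 0 ≤ ε * (i : ℝ) ^ σ := by positivity
    linarith
  · obtain ⟨h1, h2⟩ := hN i hi
    rw [div_lt_iff₀ (Real.rpow_pos_of_pos (by exact_mod_cast h2) _)] at h1
    linarith

/-- The Dirichlet mixture of multinomial weights. -/
theorem integral_multinomialWeight {S : ℕ} (hS : 0 < S) (n : ℕ) (l : Fin (S + 1) →₀ ℕ)
    (hl : ∑ k, l k = n) :
    ∫ V, multinomialWeight n V l ∂(urnDirichlet S) =
      n.factorial * (∏ k, rising S 1 (l k) / (l k).factorial) / rising S (S + 1) n := by
  have h : ∀ V : Fin (S + 1) → ℝ, multinomialWeight n V l =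
      n.factorial / (∏ k, ((l k).factorial : ℝ)) * ∏ k, V k ^ l k := by
    intro V
    rw [multinomialWeight, Finset.prod_div_distrib]
    ring
  simp_rw [h]
  rw [integral_const_mul, integral_urnDirichlet_prod_pow hS, hl, Finset.prod_div_distrib]
  ring

theorem measurable_multinomialWeight {N : ℕ} (n : ℕ) (l : Fin N →₀ ℕ) :
    Measurable fun V : Fin N → ℝ => multinomialWeight n V l := by
  unfold multinomialWeight
  fun_prop

theorem norm_sum_multinomialWeight_mul_le {N : ℕ} [NeZero N] (n : ℕ) {V : Fin N → ℝ}
    (hV : (∀ k, 0 ≤ V k) ∧ ∑ k, V k = 1) {φ : (Fin N →₀ ℕ) → ℂ} (hφ : ∀ l, ‖φ l‖ ≤ 1) :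
    ‖∑ l ∈ Finset.finsuppAntidiag Finset.univ n, (multinomialWeight n V l : ℂ) * φ l‖ ≤ 1 := by
  rw [← sum_multinomialWeight n hV.2 0]
  refine (norm_sum_le _ _).trans (Finset.sum_le_sum fun l _ => ?_)
  rw [norm_mul, Complex.norm_real, Real.norm_of_nonneg (multinomialWeight_nonneg n hV.1 l)]
  exact mul_le_of_le_one_right (multinomialWeight_nonneg n hV.1 l) (hφ l)

section System

variable {Ω Ω₁ Ω₂ : Type*} [MeasurableSpace Ω] [MeasurableSpace Ω₁] [MeasurableSpace Ω₂]
  {P : Measure Ω} {P₁ : Measure Ω₁} {P₂ : Measure Ω₂} [IsProbabilityMeasure P]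
  [IsProbabilityMeasure P₁] [IsProbabilityMeasure P₂] {a b c d S m : ℕ}
  {U : ℕ → Ω → ℕ × ℕ} {U₁ : ℕ → Ω₁ → ℕ × ℕ} {U₂ : ℕ → Ω₂ → ℕ × ℕ}

theorem sum_ite_unit_composition {S r : ℕ} (hr : r ≤ S + 1) :
    ∑ k : Fin (S + 1), (if (k : ℕ) < r then ((1, 0) : ℕ × ℕ) else (0, 1)) = (r, S + 1 - r) := by
  rw [Fin.sum_univ_eq_sum_range (fun k => if k < r then ((1, 0) : ℕ × ℕ) else (0, 1)) (S + 1),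
    ← Finset.sum_range_add_sum_Ico _ hr]
  rw [Finset.sum_congr rfl (g := fun _ => ((1, 0) : ℕ × ℕ))
      (fun k hk => if_pos (Finset.mem_range.1 hk)),
    Finset.sum_congr rfl (g := fun _ => ((0, 1) : ℕ × ℕ))
      (fun k hk => if_neg (not_lt.2 (Finset.mem_Ico.1 hk).1))]
  simp

/-- The branching decomposition of an urn containing `S + 1` balls. -/
theorem iterate_urnCharacter_eq_integral (hab : a + b = S) (hcd : c + d = S) (hS : 0 < S)
    (hU₁ : IsPolyaUrn P₁ a b c d (1, 0) U₁) (hU₂ : IsPolyaUrn P₂ a b c d (0, 1) U₂) {r : ℕ}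
    (hr : r ≤ S + 1) (n : ℕ) (s : ℝ) :
    (urnGenerator a b c d)^[n] (urnCharacter b c S s) (r, S + 1 - r) =
      rising S (S + 1) n * ∫ V, ∑ l ∈ Finset.finsuppAntidiag Finset.univ n,
        (multinomialWeight n V l : ℂ) * ∏ k : Fin (S + 1), charFun
          (if (k : ℕ) < r then urnFormLaw b c S P₁ U₁ (l k) else urnFormLaw b c S P₂ U₂ (l k)) s
        ∂(urnDirichlet S) := by
  have := isProbabilityMeasure_urnDirichlet hS
  set φ : Fin (S + 1) → ℕ → ℂ := fun k i => charFun
    (if (k : ℕ) < r then urnFormLaw b c S P₁ U₁ i else urnFormLaw b c S P₂ U₂ i) s with hφ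
  have hr0 : (rising S (S + 1) n : ℂ) ≠ 0 := by
    exact_mod_cast (rising_pos S (by positivity) n).ne'
  have hfac : ∀ k : ℕ, (k.factorial : ℂ) ≠ 0 := fun k => by exact_mod_cast k.factorial_ne_zero
  have hint : ∀ l ∈ Finset.finsuppAntidiag (Finset.univ : Finset (Fin (S + 1))) n,
      Integrable (fun V : Fin (S + 1) → ℝ => (multinomialWeight n V l : ℂ) * ∏ k, φ k (l k))
        (urnDirichlet S) := by
    intro l hl
    refine Integrable.mul_const (Integrable.ofReal ?_) _
    refine Integrable.of_bound (C := 1) (measurable_multinomialWeight n l).aestronglyMeasurable ?_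
    filter_upwards [ae_dirichletMeasure S fun _ => 1 / (S : ℝ)] with V hV
    change ‖multinomialWeight n V l‖ ≤ 1
    rw [Real.norm_of_nonneg (multinomialWeight_nonneg n hV.1 l), ← sum_multinomialWeight n hV.2 0]
    exact Finset.single_le_sum (f := fun l => multinomialWeight n V l)
      (fun l _ => multinomialWeight_nonneg n hV.1 l) hl
  rw [integral_finsetSum _ hint]
  -- The composition is a sum of `S + 1` single balls, so its series is the product of their
  -- one-ball series; the index `l` records how many draws fall in each subtree.
  have hcoeff := congrArg (PowerSeries.coeff n) (urnSeries_sum a b c d (urnCharacter_add b c S s)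
    (urnCharacter_zero b c S s) (Finset.univ : Finset (Fin (S + 1)))
    (fun k => if (k : ℕ) < r then ((1, 0) : ℕ × ℕ) else (0, 1)))
  rw [sum_ite_unit_composition hr, PowerSeries.coeff_prod] at hcoeff
  simp only [urnSeries, PowerSeries.coeff_mk] at hcoeff
  rw [div_eq_iff (hfac n)] at hcoeff
  rw [hcoeff, Finset.sum_mul, Finset.mul_sum]
  refine Finset.sum_congr rfl fun l hl => ?_
  rw [integral_mul_const, integral_complex_ofReal,
    integral_multinomialWeight hS n l (Finset.mem_finsuppAntidiag.1 hl).1]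
  have hterm : ∀ k : Fin (S + 1), (urnGenerator a b c d)^[l k] (urnCharacter b c S s)
      (if (k : ℕ) < r then ((1, 0) : ℕ × ℕ) else (0, 1)) / ((l k).factorial : ℂ) =
      (rising S 1 (l k) : ℂ) / (l k).factorial * φ k (l k) := by
    intro k
    simp only [hφ]
    split_ifs
    · rw [hU₁.iterate_urnCharacter hab hcd rfl]; ring
    · rw [hU₂.iterate_urnCharacter hab hcd rfl]; ring
  simp_rw [hterm]
  rw [Finset.prod_mul_distrib]
  push_cast
  field_simp

/-- Hypothesis `hstep` says that the first draw is forced and leads to `S + 1` balls. Thus `n + 1`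
draws of `U` are `n` draws of that larger urn, and both descriptions of the characteristic function
at `t / n ^ σ` have limits. -/
theorem IsPolyaUrn.map_limit_eq_smoothingLaw (hab : a + b = S) (hcd : c + d = S) (hm : a = c + m)
    (hS : 0 < S) (hlarge : S < 2 * m) (hU₁ : IsPolyaUrn P₁ a b c d (1, 0) U₁)
    (hU₂ : IsPolyaUrn P₂ a b c d (0, 1) U₂) {x₀ : ℕ × ℕ} (hx : x₀.1 + x₀.2 = 1)
    (hU : IsPolyaUrn P a b c d x₀ U) {r : ℕ} (hr : r ≤ S + 1)
    (hstep : ∀ g : ℕ × ℕ → ℂ, urnGenerator a b c d g x₀ = g (r, S + 1 - r)) :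
    P.map (urnLimit b c S ((m : ℝ) / S) U) =
      smoothingLaw S ((m : ℝ) / S) r (P₁.map (urnLimit b c S ((m : ℝ) / S) U₁))
        (P₂.map (urnLimit b c S ((m : ℝ) / S) U₂)) := by
  have hD := isProbabilityMeasure_urnDirichlet hS
  have hmem := (hU.limit hab hcd hm hS hlarge hx).2.1
  have hmem₁ := (hU₁.limit hab hcd hm hS hlarge rfl).2.1
  have hmem₂ := (hU₂.limit hab hcd hm hS hlarge rfl).2.1
  have hS' : (0 : ℝ) < S := by exact_mod_cast hS
  have hm0 : (0 : ℝ) < m := by exact_mod_cast (by omega : 0 < m)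
  set σ : ℝ := (m : ℝ) / S with hσ
  have hσ0 : 0 < σ := div_pos hm0 hS'
  set W := urnLimit b c S σ U with hW
  set W₁ := urnLimit b c S σ U₁ with hW₁
  set W₂ := urnLimit b c S σ U₂ with hW₂
  have p0 : IsProbabilityMeasure (P.map W) :=
    Measure.isProbabilityMeasure_map hmem.aestronglyMeasurable.aemeasurable
  have p1 : IsProbabilityMeasure (P₁.map W₁) :=
    Measure.isProbabilityMeasure_map hmem₁.aestronglyMeasurable.aemeasurable
  have p2 : IsProbabilityMeasure (P₂.map W₂) :=
    Measure.isProbabilityMeasure_map hmem₂.aestronglyMeasurable.aemeasurable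
  have p3 := isProbabilityMeasure_smoothingLaw hS σ r (P₁.map W₁) (P₂.map W₂)
  have q1 := hU₁.isProbabilityMeasure_formLaw (S := S)
  have q2 := hU₂.isProbabilityMeasure_formLaw (S := S)
  refine Measure.ext_of_charFun (funext fun t => ?_)
  -- The time is `n + 1` but the scale is `n ^ σ`, because the first draw is not shared among the
  -- subtrees; `hq` shows that the mismatch is negligible.
  have hlim1 : Tendsto (fun n : ℕ => charFun (urnFormLaw b c S P U (n + 1)) (t / (n : ℝ) ^ σ))
      atTop (𝓝 (charFun (P.map W) t)) := by
    have hq : Tendsto (fun n : ℕ => (((n + 1 : ℕ) : ℝ) / n) ^ σ) atTop (𝓝 1) := by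
      have h1 : Tendsto (fun n : ℕ => 1 + 1 / (n : ℝ)) atTop (𝓝 (1 + 0)) :=
        tendsto_const_nhds.add tendsto_one_div_atTop_nhds_zero_nat
      have h2 := h1.rpow_const (p := σ) (Or.inl (by norm_num))
      rw [add_zero, Real.one_rpow] at h2
      refine h2.congr' ?_
      filter_upwards [eventually_gt_atTop 0] with n hn
      have hn' : (n : ℝ) ≠ 0 := by positivity
      congr 1
      push_cast
      field_simp
    have he : Tendsto (fun n : ℕ => urnError b c S σ P U (n + 1) / ((n + 1 : ℕ) : ℝ) ^ σ) atTop
        (𝓝 0) :=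
      (hU.tendsto_urnError_div hab hcd hm hS hlarge hx).comp (tendsto_add_atTop_nat 1)
    have hlim : Tendsto (fun n : ℕ => |t| * (urnError b c S σ P U (n + 1) / (n : ℝ) ^ σ +
        |(((n + 1 : ℕ) : ℝ) / n) ^ σ - 1| * ∫ ω, |W ω| ∂P)) atTop (𝓝 0) := by
      have h3 : Tendsto (fun n : ℕ => urnError b c S σ P U (n + 1) / (n : ℝ) ^ σ) atTop (𝓝 0) := by
        have := he.mul hq
        rw [zero_mul] at this
        refine this.congr' ?_
        filter_upwards [eventually_gt_atTop 0] with n hn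
        have hn' : (0 : ℝ) < n := by exact_mod_cast hn
        have : (0 : ℝ) < ((n + 1 : ℕ) : ℝ) ^ σ := by positivity
        rw [Real.div_rpow (by positivity) (by positivity)]
        field_simp
      have := (h3.add (((hq.sub_const 1).abs).mul_const (∫ ω, |W ω| ∂P))).const_mul |t|
      simpa using this
    refine tendsto_iff_norm_sub_tendsto_zero.2 (squeeze_zero' (Eventually.of_forall fun n =>
      norm_nonneg _) ?_ hlim)
    filter_upwards [eventually_gt_atTop 0] with n hn
    have := hU.norm_charFun_sub_le hab hcd hm hS hlarge hx t (n + 1) n hn 1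
    rwa [Real.one_rpow, mul_one] at this
  have hlim2 : Tendsto (fun n : ℕ => ∫ V, ∑ l ∈ Finset.finsuppAntidiag Finset.univ n,
      (multinomialWeight n V l : ℂ) * ∏ k : Fin (S + 1), charFun
        (if (k : ℕ) < r then urnFormLaw b c S P₁ U₁ (l k) else urnFormLaw b c S P₂ U₂ (l k))
          (t / (n : ℝ) ^ σ) ∂(urnDirichlet S)) atTop
      (𝓝 (charFun (smoothingLaw S σ r (P₁.map W₁) (P₂.map W₂)) t)) := by
    rw [charFun_smoothingLaw hS]
    refine tendsto_integral_of_dominated_convergence (fun _ => 1) (fun n => ?_)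
      (integrable_const 1) (fun n => ?_) ?_
    · refine Measurable.aestronglyMeasurable (Finset.measurable_sum _ fun l _ => ?_)
      exact (Complex.measurable_ofReal.comp (measurable_multinomialWeight n l)).mul_const _
    · filter_upwards [ae_dirichletMeasure S fun _ => 1 / (S : ℝ)] with V hV
      refine norm_sum_multinomialWeight_mul_le n hV fun l => ?_
      rw [norm_prod]
      exact Finset.prod_le_one (fun _ _ => norm_nonneg _) fun k _ => norm_charFun_le_one _
    · filter_upwards [ae_dirichletMeasure S fun _ => 1 / (S : ℝ)] with V hV
      refine tendsto_multinomial_prod hV hσ0 t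
        (φ := fun k i s => charFun (if (k : ℕ) < r then urnFormLaw b c S P₁ U₁ i
          else urnFormLaw b c S P₂ U₂ i) s)
        (ψ := fun k s => charFun (if (k : ℕ) < r then P₁.map W₁ else P₂.map W₂) s)
        (η := fun k i => if (k : ℕ) < r then urnError b c S σ P₁ U₁ i
          else urnError b c S σ P₂ U₂ i)
        (C := fun k => if (k : ℕ) < r then ∫ ω, |W₁ ω| ∂P₁ else ∫ ω, |W₂ ω| ∂P₂)
        (fun k i s => norm_charFun_le_one _) (fun k s => norm_charFun_le_one _) ?_ ?_ ?_
      · intro k i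
        split_ifs <;> exact urnError_nonneg _ _ _ _ _ _ _
      · intro k ε hε
        split_ifs
        · exact exists_le_rpow_add_of_tendsto_div (urnError_nonneg _ _ _ _ _ _)
            (hU₁.tendsto_urnError_div hab hcd hm hS hlarge rfl) hε
        · exact exists_le_rpow_add_of_tendsto_div (urnError_nonneg _ _ _ _ _ _)
            (hU₂.tendsto_urnError_div hab hcd hm hS hlarge rfl) hε
      · intro k i n hn v _
        split_ifs
        · exact hU₁.norm_charFun_sub_le hab hcd hm hS hlarge rfl t i n hn v
        · exact hU₂.norm_charFun_sub_le hab hcd hm hS hlarge rfl t i n hn v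
  refine tendsto_nhds_unique (hlim1.congr fun n => ?_) hlim2
  have h1 := hU.iterate_urnCharacter hab hcd hx (n + 1) (t / (n : ℝ) ^ σ)
  -- The normalizations of the two sides agree exactly, since `rising S 1 (n + 1) = rising S (S + 1)
  -- n`.
  rw [Function.iterate_succ_apply', hstep,
    iterate_urnCharacter_eq_integral hab hcd hS hU₁ hU₂ hr, rising_succ', one_mul,
    add_comm (1 : ℝ)] at h1
  have hr0 : (rising S (S + 1) n : ℂ) ≠ 0 := by
    exact_mod_cast (rising_pos S (by positivity) n).ne'
  exact (mul_left_cancel₀ hr0 h1).symm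

end System

/-! ### Existence of the urn process -/

/-- One step of the urn driven by a uniform variable `u`. -/
def urnUpdate (a b c d : ℕ) (x : ℕ × ℕ) (u : ℝ) : ℕ × ℕ :=
  if u ≤ (x.1 : ℝ) / ((x.1 : ℝ) + x.2) then (x.1 + a, x.2 + b) else (x.1 + c, x.2 + d)

/-- The uniform distribution on the unit interval. -/
def uniformLaw : Measure ℝ := volume.restrict (Set.Ioc 0 1)

instance : IsProbabilityMeasure uniformLaw := ⟨by simp [uniformLaw]⟩

/-- The urn process driven by a sequence of uniform variables. -/
def urnProcess (a b c d : ℕ) (x₀ : ℕ × ℕ) : ℕ → (ℕ → ℝ) → ℕ × ℕ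
  | 0, _ => x₀
  | n + 1, ω => urnUpdate a b c d (urnProcess a b c d x₀ n ω) (ω (n + 1))

theorem measurable_urnUpdate (a b c d : ℕ) (x : ℕ × ℕ) : Measurable (urnUpdate a b c d x) :=
  Measurable.ite measurableSet_Iic measurable_const measurable_const

theorem uniformLaw_urnUpdate (a b c d : ℕ) {x : ℕ × ℕ} (hx : 0 < x.1 + x.2) (y : ℕ × ℕ) :
    uniformLaw (urnUpdate a b c d x ⁻¹' {y}) = urnStep a b c d x y := by
  have hx' : (0 : ℝ) < (x.1 : ℝ) + x.2 := by exact_mod_cast hx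
  set p : ℝ := (x.1 : ℝ) / ((x.1 : ℝ) + x.2) with hp
  have hp0 : 0 ≤ p := by positivity
  have hp1 : p ≤ 1 := by rw [hp, div_le_one hx']; simp
  have hE : ∀ z : ℕ, (z : ℝ≥0∞) / ((x.1 : ℝ≥0∞) + x.2) =
      ENNReal.ofReal ((z : ℝ) / ((x.1 : ℝ) + x.2)) := fun z => by
    rw [ENNReal.ofReal_div_of_pos hx', ENNReal.ofReal_add (by positivity) (by positivity)]
    simp
  have h1 : uniformLaw (Set.Iic p) = ENNReal.ofReal p := by
    rw [uniformLaw, Measure.restrict_apply measurableSet_Iic, Set.inter_comm, Set.Ioc_inter_Iic,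
      min_eq_right hp1, Real.volume_Ioc, sub_zero]
  have h2 : uniformLaw (Set.Ioi p) = ENNReal.ofReal ((x.2 : ℝ) / ((x.1 : ℝ) + x.2)) := by
    rw [uniformLaw, Measure.restrict_apply measurableSet_Ioi, Set.inter_comm, Set.Ioc_inter_Ioi,
      max_eq_right hp0, Real.volume_Ioc]
    congr 1
    rw [hp]; field_simp; ring
  have hset : urnUpdate a b c d x ⁻¹' {y} =
      (if y = (x.1 + a, x.2 + b) then Set.Iic p else ∅) ∪
        (if y = (x.1 + c, x.2 + d) then Set.Ioi p else ∅) := by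
    ext u
    have hu0 : urnUpdate a b c d x u =
        if u ≤ p then (x.1 + a, x.2 + b) else (x.1 + c, x.2 + d) := rfl
    rw [Set.mem_preimage, Set.mem_singleton_iff, Set.mem_union, hu0]
    by_cases hu : u ≤ p
    · rw [if_pos hu]
      refine ⟨fun h => Or.inl ?_, ?_⟩
      · rw [if_pos h.symm]; exact hu
      · rintro (h | h) <;> split_ifs at h with e
        · exact e.symm
        · exact h.elim
        · exact absurd hu (not_le.2 h)
        · exact h.elim
    · rw [if_neg hu]
      refine ⟨fun h => Or.inr ?_, ?_⟩
      · rw [if_pos h.symm]; exact not_le.1 hu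
      · rintro (h | h) <;> split_ifs at h with e
        · exact absurd h hu
        · exact h.elim
        · exact e.symm
        · exact h.elim
  rw [hset, measure_union, urnStep, hE, hE, ← h2, ← hp, ← h1]
  · congr 1 <;> split_ifs <;> simp
  · rw [Set.disjoint_left]
    intro u h h'
    split_ifs at h h'
    · exact absurd (Set.mem_Iic.1 h) (not_le.2 (Set.mem_Ioi.1 h'))
    all_goals first | exact h.elim | exact h'.elim
  · split_ifs
    · exact measurableSet_Ioi
    · exact MeasurableSet.empty

/-- The filtration generated by the coordinates. -/
abbrev coordinateFiltration : Filtration ℕ (inferInstance : MeasurableSpace (ℕ → ℝ)) :=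
  Filtration.natural (fun i (ω : ℕ → ℝ) => ω i) fun i => (measurable_pi_apply i).stronglyMeasurable

theorem measurable_urnProcess_natural (a b c d : ℕ) (x₀ : ℕ × ℕ) (n : ℕ) :
    Measurable[coordinateFiltration n] (urnProcess a b c d x₀ n) := by
  induction n with
  | zero => exact measurable_const
  | succ n ih =>
    have h1 : Measurable[coordinateFiltration (n + 1)] (urnProcess a b c d x₀ n) :=
      ih.mono (coordinateFiltration.mono n.le_succ) le_rfl
    have h2 : Measurable[coordinateFiltration (n + 1)] (fun ω : ℕ → ℝ => ω (n + 1)) :=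
      Measurable.of_comap_le (le_iSup₂_of_le (n + 1) le_rfl le_rfl)
    have h3 : Measurable (fun p : (ℕ × ℕ) × ℝ => urnUpdate a b c d p.1 p.2) :=
      measurable_from_prod_countable_right fun x => measurable_urnUpdate a b c d x
    exact h3.comp (h1.prodMk h2)

theorem urnProcess_total_pos (a b c d : ℕ) {x₀ : ℕ × ℕ} (hx : 0 < x₀.1 + x₀.2) (n : ℕ) (ω : ℕ → ℝ) :
    0 < (urnProcess a b c d x₀ n ω).1 + (urnProcess a b c d x₀ n ω).2 := by
  induction n with
  | zero => exact hx
  | succ n ih =>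
    simp only [urnProcess, urnUpdate]
    split_ifs <;> (dsimp only; omega)

/-- The path up to time `n` depends only on the coordinates up to `n`, and the next draw uses the
independent coordinate `n + 1`. -/
theorem isPolyaUrn_urnProcess (a b c d : ℕ) {x₀ : ℕ × ℕ} (hx : 0 < x₀.1 + x₀.2) :
    IsPolyaUrn (Measure.infinitePi fun _ : ℕ => uniformLaw) a b c d x₀
      (urnProcess a b c d x₀) where
  measurable n := (measurable_urnProcess_natural a b c d x₀ n).mono (coordinateFiltration.le n) le_rfl
  initial := ae_of_all _ fun _ => rfl
  transition n h := by
    set A := {ω | ∀ i ≤ n, urnProcess a b c d x₀ i ω = h i} with hA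
    have hAm : MeasurableSet[coordinateFiltration n] A := by
      have : A = ⋂ i, ⋂ _ : i ≤ n, urnProcess a b c d x₀ i ⁻¹' {h i} := by ext; simp [hA]
      rw [this]
      refine MeasurableSet.iInter fun i => MeasurableSet.iInter fun hi => ?_
      exact coordinateFiltration.mono hi _
        (measurable_urnProcess_natural a b c d x₀ i (measurableSet_singleton _))
    have hset : {ω | ∀ i ≤ n + 1, urnProcess a b c d x₀ i ω = h i} =
        (fun ω : ℕ → ℝ => ω (n + 1)) ⁻¹' (urnUpdate a b c d (h n) ⁻¹' {h (n + 1)}) ∩ A := by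
      ext ω
      simp only [hA, Set.mem_ofPred_eq, Set.mem_inter_iff, Set.mem_preimage, Set.mem_singleton_iff]
      constructor
      · intro H
        refine ⟨?_, fun i hi => H i (by omega)⟩
        rw [← H n (by omega), ← H (n + 1) le_rfl]
        rfl
      · rintro ⟨H1, H2⟩ i hi
        rcases Nat.lt_or_ge n i with hi' | hi'
        · obtain rfl : i = n + 1 := by omega
          rw [← H1, ← H2 n le_rfl]
          rfl
        · exact H2 i hi'
    rw [hset]
    -- A prescribed empty composition has probability zero, since the process always contains a
    -- ball; otherwise the uniform variable realizes `urnStep`.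
    rcases Nat.eq_zero_or_pos ((h n).1 + (h n).2) with h0 | h0
    · have hAe : A = ∅ := by
        ext ω
        simp only [hA, Set.mem_ofPred_eq, Set.mem_empty_iff_false, iff_false]
        intro H
        have := urnProcess_total_pos a b c d hx n ω
        rw [H n le_rfl] at this
        omega
      simp [hAe]
    · have hind := ProbabilityTheory.iIndepFun.indep_comap_natural_of_lt
        (f := fun i (ω : ℕ → ℝ) => ω i) (μ := Measure.infinitePi fun _ : ℕ => uniformLaw)
        (fun i => (measurable_pi_apply i).stronglyMeasurable)
        (ProbabilityTheory.iIndepFun_infinitePi (X := fun _ x => x) fun _ => measurable_id)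
        n.lt_succ_self
      have hms := measurable_urnUpdate a b c d (h n) (measurableSet_singleton (h (n + 1)))
      have hmul := (ProbabilityTheory.Indep_iff _ _ _).1 hind _ A ⟨_, hms, rfl⟩ hAm
      rw [hmul, mul_comm]
      congr 1
      rw [← uniformLaw_urnUpdate a b c d h0]
      exact (measurePreserving_eval_infinitePi (fun _ : ℕ => uniformLaw) (n + 1)).measure_preimage
        hms.nullMeasurableSet

/-! ### The main theorem -/

/-- The first draw turns `(1, 0)` into `(a + 1, b)` and `(0, 1)` into `(c, d + 1)`. These are the
numbers of copies of each law in the two equations. -/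
theorem urnLaws_isSolution {a b c d S m : ℕ} (hab : a + b = S) (hcd : c + d = S) (hm : a = c + m)
    (hlarge : S < 2 * m) {Ω₁ Ω₂ : Type*} [MeasurableSpace Ω₁]
    [MeasurableSpace Ω₂] {P₁ : Measure Ω₁} {P₂ : Measure Ω₂} [IsProbabilityMeasure P₁]
    [IsProbabilityMeasure P₂] {U₁ : ℕ → Ω₁ → ℕ × ℕ} {U₂ : ℕ → Ω₂ → ℕ × ℕ}
    (hU₁ : IsPolyaUrn P₁ a b c d (1, 0) U₁) (hU₂ : IsPolyaUrn P₂ a b c d (0, 1) U₂) :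
    (P₁.map (urnLimit b c S ((m : ℝ) / S) U₁), P₂.map (urnLimit b c S ((m : ℝ) / S) U₂)) ∈
        M2 (Real.Gamma (1 / (S : ℝ)) / Real.Gamma (((m : ℝ) + 1) / S) * ((b : ℝ) / S)) ×ˢ
          M2 (-(Real.Gamma (1 / (S : ℝ)) / Real.Gamma (((m : ℝ) + 1) / S) * ((c : ℝ) / S))) ∧
      IsSystemSolution a c S ((m : ℝ) / S)
        (P₁.map (urnLimit b c S ((m : ℝ) / S) U₁), P₂.map (urnLimit b c S ((m : ℝ) / S) U₂)) := by
  have hS : 0 < S := by omega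
  obtain ⟨-, L1, E1, -⟩ := hU₁.limit hab hcd hm hS hlarge rfl
  obtain ⟨-, L2, E2, -⟩ := hU₂.limit hab hcd hm hS hlarge rfl
  have m1 := L1.aestronglyMeasurable.aemeasurable
  have m2 := L2.aestronglyMeasurable.aemeasurable
  refine ⟨⟨⟨Measure.isProbabilityMeasure_map m1, (memLp_map_measure_iff (by fun_prop) m1).2 L1, ?_⟩,
    ⟨Measure.isProbabilityMeasure_map m2, (memLp_map_measure_iff (by fun_prop) m2).2 L2, ?_⟩⟩,
    ?_, ?_⟩
  · rw [integral_map m1 (by fun_prop), E1]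
    simp [urnForm]
  · rw [integral_map m2 (by fun_prop), E2]
    simp [urnForm, neg_div]
  · refine IsPolyaUrn.map_limit_eq_smoothingLaw hab hcd hm hS hlarge hU₁ hU₂ rfl hU₁
      (by omega) fun g => ?_
    simp only [urnGenerator, Nat.cast_one, Nat.cast_zero, one_smul, zero_smul, add_zero]
    congr 1
    ext <;> dsimp only <;> omega
  · refine IsPolyaUrn.map_limit_eq_smoothingLaw hab hcd hm hS hlarge hU₁ hU₂ rfl hU₂
      (by omega) fun g => ?_
    simp only [urnGenerator, Nat.cast_one, Nat.cast_zero, one_smul, zero_smul, zero_add]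
    congr 1
    ext <;> dsimp only <;> omega

theorem exists_systemSolution {a b c d S m : ℕ} (hab : a + b = S) (hcd : c + d = S)
    (hm : a = c + m) (hb : b ≠ 0) (hlarge : S < 2 * m) {B C : ℝ}
    (hBC : (c : ℝ) * B + (b : ℝ) * C = 0) :
    ∃ p : Measure ℝ × Measure ℝ,
      p ∈ M2 B ×ˢ M2 C ∧ IsSystemSolution a c S ((m : ℝ) / S) p := by
  have hS : 0 < S := by omega
  have hS' : (S : ℝ) ≠ 0 := by positivity
  have hb' : (b : ℝ) ≠ 0 := by exact_mod_cast hb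
  obtain ⟨⟨h1, h2⟩, hs⟩ := urnLaws_isSolution hab hcd hm hlarge
    (isPolyaUrn_urnProcess a b c d (x₀ := (1, 0)) (by simp))
    (isPolyaUrn_urnProcess a b c d (x₀ := (0, 1)) (by simp))
  set ℓ := Real.Gamma (1 / (S : ℝ)) / Real.Gamma (((m : ℝ) + 1) / S) with hℓ
  have hℓ0 : ℓ ≠ 0 := (div_pos (Real.Gamma_pos_of_pos (by positivity))
    (Real.Gamma_pos_of_pos (by positivity))).ne'
  -- The dilation sends the first mean to `B`. The second becomes `-c B / b`, which equals `C` by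
  -- the linear relation. A negative or zero factor is allowed.
  refine ⟨_, ⟨?_, ?_⟩, hs.map_mul hS h1.1 h2.1 (B / (ℓ * (b / S)))⟩
  · have := map_mul_mem_M2 h1 (B / (ℓ * (b / S)))
    rwa [div_mul_cancel₀ _ (by positivity)] at this
  · have := map_mul_mem_M2 h2 (B / (ℓ * (b / S)))
    have e : B / (ℓ * (b / S)) * -(ℓ * (c / S)) = C := by
      field_simp
      linarith
    rwa [e] at this

/-- Because `bC = -cB`, the first mean is `((a + 1) B + b C) / (m + 1) = (a + 1 - c) B / (m + 1) =
B`. Likewise `c B + (d + 1) C = (m + 1) C`. -/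
theorem smoothingTransform_mapsTo {a b c d S m : ℕ} (hab : a + b = S) (hcd : c + d = S)
    (hm : a = c + m) (hb : b ≠ 0) {B C : ℝ} (hBC : (c : ℝ) * B + (b : ℝ) * C = 0) :
    Set.MapsTo (smoothingTransform a c S ((m : ℝ) / S)) (M2 B ×ˢ M2 C) (M2 B ×ˢ M2 C) := by
  have hS : 0 < S := by omega
  have hS' : (S : ℝ) ≠ 0 := by positivity
  have hσ : (0 : ℝ) ≤ (m : ℝ) / S := by positivity
  have hm1 : 1 + (m : ℝ) ≠ 0 := by positivity
  have e1 : (S : ℝ) = c + m + b := by rw [← hab, hm]; push_cast; ring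
  have e2 : (a : ℝ) = c + m := by rw [hm]; push_cast; ring
  rintro ⟨μ, ν⟩ ⟨hμ, hν⟩
  have h1 := smoothingLaw_mem_M2 hS hσ (r := a + 1) (by omega) hμ hν
  have h2 := smoothingLaw_mem_M2 hS hσ (r := c) (by omega) hμ hν
  rw [div_mul_cancel₀ _ hS'] at h1 h2
  have f1 : 1 / (1 + (m : ℝ)) * ((a + 1 : ℕ) * B + (S + 1 - (a + 1 : ℕ)) * C) = B := by
    push_cast
    rw [e1, e2]
    field_simp
    linear_combination hBC
  have f2 : 1 / (1 + (m : ℝ)) * (c * B + (S + 1 - c) * C) = C := by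
    rw [e1]
    field_simp
    linear_combination hBC
  rw [f1] at h1
  rw [f2] at h2
  exact ⟨h1, h2⟩

end

theorem mainTheorem1 (a b c d S m : ℕ) (hab : a + b = S) (hcd : c + d = S) (hm : a = c + m)
    (hb : b ≠ 0) (hc : c ≠ 0) (hlarge : S < 2 * m) :
    (∀ B C : ℝ, (c : ℝ) * B + (b : ℝ) * C = 0 →
      (Set.MapsTo (smoothingTransform a c S ((m : ℝ) / S)) (M2 B ×ˢ M2 C) (M2 B ×ˢ M2 C) ∧
        (∀ p ∈ M2 B ×ˢ M2 C, ∀ q ∈ M2 B ×ˢ M2 C,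
          pairDist (smoothingTransform a c S ((m : ℝ) / S) p)
              (smoothingTransform a c S ((m : ℝ) / S) q) ≤
            ENNReal.ofReal (Real.sqrt (((S : ℝ) + 1) / (2 * (m : ℝ) + 1))) * pairDist p q) ∧
        Real.sqrt (((S : ℝ) + 1) / (2 * (m : ℝ) + 1)) < 1) ∧
      ∃! p : Measure ℝ × Measure ℝ,
        p ∈ M2 B ×ˢ M2 C ∧ IsSystemSolution a c S ((m : ℝ) / S) p) ∧
    (∀ (Ω₁ : Type*) [MeasurableSpace Ω₁] (P₁ : Measure Ω₁) [IsProbabilityMeasure P₁]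
      (Ω₂ : Type*) [MeasurableSpace Ω₂] (P₂ : Measure Ω₂) [IsProbabilityMeasure P₂]
      (U₁ : ℕ → Ω₁ → ℕ × ℕ) (U₂ : ℕ → Ω₂ → ℕ × ℕ),
      IsPolyaUrn P₁ a b c d (1, 0) U₁ → IsPolyaUrn P₂ a b c d (0, 1) U₂ →
      (∀ᵐ ω ∂P₁, Tendsto (urnNormalized b c S ((m : ℝ) / S) (fun n => U₁ n ω)) atTop
        (𝓝 (urnLimit b c S ((m : ℝ) / S) U₁ ω))) ∧
      (∀ᵐ ω ∂P₂, Tendsto (urnNormalized b c S ((m : ℝ) / S) (fun n => U₂ n ω)) atTop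
        (𝓝 (urnLimit b c S ((m : ℝ) / S) U₂ ω))) ∧
      ∀ p : Measure ℝ × Measure ℝ,
        (p ∈ M2 (Real.Gamma (1 / (S : ℝ)) / Real.Gamma (((m : ℝ) + 1) / S) * ((b : ℝ) / S)) ×ˢ
              M2 (-(Real.Gamma (1 / (S : ℝ)) / Real.Gamma (((m : ℝ) + 1) / S) * ((c : ℝ) / S))) ∧
            IsSystemSolution a c S ((m : ℝ) / S) p) ↔
          p = (P₁.map (urnLimit b c S ((m : ℝ) / S) U₁),
            P₂.map (urnLimit b c S ((m : ℝ) / S) U₂))) := by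
  have hS : 0 < S := by omega
  have hS' : (S : ℝ) ≠ 0 := by positivity
  refine ⟨fun B C hBC => ⟨⟨smoothingTransform_mapsTo hab hcd hm hb hBC, fun p hp q hq => ?_,
    lipschitzConst_lt_one hlarge⟩, ?_⟩, ?_⟩
  · have h := pairDist_smoothingTransform_le (a := a) (c := c) hS
      (by positivity : 0 ≤ (m : ℝ) / S) hp hq
    rwa [show 2 * ((m : ℝ) / S) * S + 1 = 2 * m + 1 by field_simp] at h
  · obtain ⟨p, hp, hps⟩ := exists_systemSolution hab hcd hm hb hlarge hBC
    exact ⟨p, ⟨hp, hps⟩, fun q hq => IsSystemSolution.unique hS hlarge hq.1 hp hq.2 hps⟩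
  · intro Ω₁ _ P₁ _ Ω₂ _ P₂ _ U₁ U₂ hU₁ hU₂
    refine ⟨(hU₁.limit hab hcd hm hS hlarge rfl).1, (hU₂.limit hab hcd hm hS hlarge rfl).1,
      fun p => ⟨fun hp => ?_, ?_⟩⟩
    · obtain ⟨h1, h2⟩ := urnLaws_isSolution hab hcd hm hlarge hU₁ hU₂
      exact IsSystemSolution.unique hS hlarge hp.1 h1 hp.2 h2
    · rintro rfl
      exact urnLaws_isSolution hab hcd hm hlarge hU₁ hU₂
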